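/- Let $A=(a_{i,j})\in\mathbb R^{n\times n}$ be an irreducible nonsingular M-matrix with unit diagonal: $a_{i,i}=1$, $a_{i,j}\le 0$ for $i\ne j$, $A$ is invertible with $A^{-1}\ge 0$, and no simultaneous permutation of rows and columns brings $A$ to the form $\begin{pmatrix}B_{1,1}&B_{1,2}\\0&B_{2,2}\end{pmatrix}$ with $B_{1,1}$ of size $r\times r$, $1\le r\le n-1$. Let $0<\omega\le 1$ and $0\le\gamma\le 1$. Let $\alpha_{i,j}\in\mathbb R$ with $\alpha_{i,i}=0$, $\alpha_{i,j}\ge 0$ for $i\neq j$, and $\sum_{i\ne j}\alpha_{i,j}a_{i,j}\neq 0$ (so $n\ge2$). Put $Q_2=(-\alpha_{i,j}a_{i,j})$ and $A^{(2)}=(I+Q_2)A$. For a square matrix $B=D-L-U$ with $D$ diagonal and $L$, $U$ strictly lower and strictly upper triangular, the AOR iteration matrix is $(D-\gamma L)^{-1}[(1-\omega)D+(\omega-\gamma)L+\omega U]$. Let $\mathscr L_{\gamma,\omega}$ and $\mathscr L^{(2)}_{\gamma,\omega}$ be the AOR iteration matrices of $A$ and $A^{(2)}$, and let $\rho$ denote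 the spectral radius. For $i\ne j$ let $$e_{i,j}=(1-\alpha_{i,j})a_{i,j}-\sum_{k\ne i,j}\alpha_{i,k}a_{i,k}a_{k,j},\qquad g_{i,j}=\alpha_{i,j}a_{i,j}+\sum_{k\ne i,j}\alpha_{i,k}a_{i,k}a_{k,j},$$ and let $$\delta_{i,j}=\begin{cases}\sum_{k\neq i}\alpha_{i,k}a_{i,k}a_{k,i}, & i=j,\\ \sum_{i<k<j}\alpha_{i,k}a_{i,k}a_{k,j}, & i<j,\\ \sum_{k<j\text{ or }k>i}\alpha_{i,k}a_{i,k}a_{k,j}, & i>j.\end{cases}$$ Consider the conditions (Z) $e_{i,j}\le 0$ for all $i\ne j$; (Z') either $e_{i,j}<0$ for all $i\neq j$ with $a_{i,j}<0$, or $A^{(2)}$ is irreducible and $e_{i,j}\le0$ for all $i\ne j$ with $a_{i,j}<0$. For a row index $i$, consider the conditions - $(r_1)$ $\delta_{i,j}>0$ for some $j$; - $(r_2)$ $i\le n-1$, $a_{i,i+1}<0$ and $\alpha_{i,i+1}>0$; - $(r_3)$ $\alpha_{i,j}a_{i,j}a_{j,i}>0$ for some $j$; - $(r_4)$ $\alpha_{i,n}a_{i,n}a_{n,j}>0$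 for some $j\le i$; - $(r_5)$ $\alpha_{i,j}a_{i,j}a_{j,1}>0$ for some $j>i$; - $(r_6)$ $\alpha_{i,j}a_{i,j}a_{j,j+1}>0$ for some $j\le n-1$; - $(r_7)$ $\alpha_{i,1}a_{i,1}a_{1,j}>0$ for some $2\le j\le i$. Suppose that at least one of the following five conditions holds. 1. $\gamma<1$ and (Z'). 2. $\gamma=1$, (Z'), and at least one of the following holds: $(r_1)$, $(r_3)$, $(r_6)$ for some $i$; $(r_2)$, $(r_4)$ or $(r_5)$ for some $i\le n-1$; $(r_7)$ for some $i\ge2$; $a_{n,1}<0$ and $\alpha_{n,1}>0$; $a_{n,1}<0$ and $a_{k,k+1}<0$ for all $k\le n-1$. 3. $\gamma<1$, (Z), and for each $i\le n-1$ there is a $j$ with $\alpha_{i,j}a_{i,j}<0$. 4. $\gamma=1$, (Z), for each $i\in\{2,\dots,n-1\}$ at least one of $(r_1)$–$(r_7)$ holds, and at least one of the following holds: (a) $\alpha_{n,k}a_{n,k}a_{k,j}>0$ for some $k<j$; (b) $a_{n,1}<0$ and $\alpha_{n,1}>0$; (c) $e_{n,j}<0$ for some $j\in\{2,\dots,n-1\}$;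 (d) one of $(r_1)$–$(r_6)$ holds for $i=1$, and $e_{n,1}<0$; (e) one of $(r_1)$–$(r_6)$ holds for $i=1$, and $a_{n,1}<0$. 5. (Z) holds, $g_{i,j}\ge0$ for all $i>j$, and either $\sum_{k\ne i}\alpha_{i,k}a_{i,k}a_{k,i}>0$ for some $i$, or $\gamma>0$ and $g_{i,j}>0$ for some $i>j$. Then, with $A^{(2)}=D_2-L_2-U_2$ decomposed as above, $D_2-\gamma L_2$ is nonsingular (so that $\mathscr L^{(2)}_{\gamma,\omega}$ is defined), and $$\rho\bigl(\mathscr L^{(2)}_{\gamma,\omega}\bigr)<\rho\bigl(\mathscr L_{\gamma,\omega}\bigr)<1 .$$ -/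

import Mathlib

namespace PrecAOR

open scoped ENNReal

noncomputable section

/-- Spectral radius of a real square matrix: the supremum of the moduli of its complex
eigenvalues. -/
def rho {n : ℕ} (B : Matrix (Fin n) (Fin n) ℝ) : ℝ≥0∞ :=
  spectralRadius ℂ (B.map (fun x : ℝ => (x : ℂ)))

/-- `B` is a Z-matrix: all off-diagonal entries are nonpositive. -/
def IsZMatrix {n : ℕ} (B : Matrix (Fin n) (Fin n) ℝ) : Prop :=
  ∀ i j, i ≠ j → B i j ≤ 0

/-- `B` is monotone: it is invertible and its inverse is semi-positive
(nonnegative with at least one positive entry). -/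
def IsMonotoneMatrix {n : ℕ} (B : Matrix (Fin n) (Fin n) ℝ) : Prop :=
  IsUnit B ∧ (∀ i j, 0 ≤ B⁻¹ i j) ∧ ∃ i j, 0 < B⁻¹ i j

/-- `B` is a nonsingular M-matrix. -/
def IsNonsingularMMatrix {n : ℕ} (B : Matrix (Fin n) (Fin n) ℝ) : Prop :=
  IsZMatrix B ∧ IsMonotoneMatrix B

/-- `B` is reducible: a simultaneous permutation of rows and columns brings it to the form
`[[B₁₁, B₁₂], [0, B₂₂]]` with `B₁₁` of size `r × r`, `1 ≤ r ≤ n - 1`. -/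
def IsReducible {n : ℕ} (B : Matrix (Fin n) (Fin n) ℝ) : Prop :=
  ∃ (σ : Equiv.Perm (Fin n)) (r : ℕ), 1 ≤ r ∧ r < n ∧
    ∀ i j : Fin n, r ≤ (i : ℕ) → (j : ℕ) < r → B.submatrix σ σ i j = 0

/-- `B` is irreducible. -/
def IsIrreducibleMatrix {n : ℕ} (B : Matrix (Fin n) (Fin n) ℝ) : Prop :=
  ¬ IsReducible B

/-! The decomposition `B = D - L - U`. -/

/-- The diagonal part `D`. -/
def diagPart {n : ℕ} (B : Matrix (Fin n) (Fin n) ℝ) : Matrix (Fin n) (Fin n) ℝ :=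
  Matrix.diagonal (fun i => B i i)

/-- The strictly lower triangular part `L`. -/
def lowerPart {n : ℕ} (B : Matrix (Fin n) (Fin n) ℝ) : Matrix (Fin n) (Fin n) ℝ :=
  Matrix.of fun i j => if j < i then -B i j else 0

/-- The strictly upper triangular part `U`. -/
def upperPart {n : ℕ} (B : Matrix (Fin n) (Fin n) ℝ) : Matrix (Fin n) (Fin n) ℝ :=
  Matrix.of fun i j => if i < j then -B i j else 0

/-- The matrix `D - γ L`. -/
def aorM {n : ℕ} (γ : ℝ) (B : Matrix (Fin n) (Fin n) ℝ) : Matrix (Fin n) (Fin n) ℝ :=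
  diagPart B - γ • lowerPart B

/-- The AOR iteration matrix `(D - γ L)⁻¹ [(1 - ω) D + (ω - γ) L + ω U]` of `B`. -/
def aorMatrix {n : ℕ} (γ ω : ℝ) (B : Matrix (Fin n) (Fin n) ℝ) : Matrix (Fin n) (Fin n) ℝ :=
  (aorM γ B)⁻¹ * ((1 - ω) • diagPart B + (ω - γ) • lowerPart B + ω • upperPart B)

/-- `Q₂ = (-α_{ij} a_{ij})`. -/
def Q₂ {n : ℕ} (A α : Matrix (Fin n) (Fin n) ℝ) : Matrix (Fin n) (Fin n) ℝ :=
  Matrix.of fun i j => -(α i j * A i j)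

/-- The requirements on the parameters `α_{ij}` of `Q₂`. -/
def IsAdmissible {n : ℕ} (A α : Matrix (Fin n) (Fin n) ℝ) : Prop :=
  (∀ i, α i i = 0) ∧ (∀ i j, i ≠ j → 0 ≤ α i j) ∧
    (∑ i, ∑ j with j ≠ i, α i j * A i j) ≠ 0

/-- The preconditioned matrix `A⁽²⁾ = P₂ A = (I + Q₂) A`. -/
def A₂ {n : ℕ} (A α : Matrix (Fin n) (Fin n) ℝ) : Matrix (Fin n) (Fin n) ℝ :=
  (1 + Q₂ A α) * A

/-- `(1 - α_{ij}) a_{ij} - ∑_{k ≠ i, j} α_{ik} a_{ik} a_{kj}`. -/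
def offEntry {n : ℕ} (A α : Matrix (Fin n) (Fin n) ℝ) (i j : Fin n) : ℝ :=
  (1 - α i j) * A i j - ∑ k with k ≠ i ∧ k ≠ j, α i k * A i k * A k j

/-- `α_{ij} a_{ij} + ∑_{k ≠ i, j} α_{ik} a_{ik} a_{kj}`. -/
def lowerGap {n : ℕ} (A α : Matrix (Fin n) (Fin n) ℝ) (i j : Fin n) : ℝ :=
  α i j * A i j + ∑ k with k ≠ i ∧ k ≠ j, α i k * A i k * A k j

/-- `∑_{k ≠ i} α_{ik} a_{ik} a_{ki}`. -/
def diagGap {n : ℕ} (A α : Matrix (Fin n) (Fin n) ℝ) (i : Fin n) : ℝ :=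
  ∑ k with k ≠ i, α i k * A i k * A k i

/-- The numbers `δ⁽²⁾_{ij}(γ)`. For `j < i` the sum runs over all `k` with
`1 ≤ k ≤ j - 1` together with all `k` with `i + 1 ≤ k ≤ n`. -/
def delta₂ {n : ℕ} (A α : Matrix (Fin n) (Fin n) ℝ) (γ : ℝ) (i j : Fin n) : ℝ :=
  if i = j then diagGap A α i
  else if i < j then
    (γ - 1) * α i j * A i j + γ * ∑ k with i < k ∧ k < j, α i k * A i k * A k j
  else
    (γ - 1) * α i j * A i j + γ * ∑ k with k < j ∨ i < k, α i k * A i k * A k j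

/-- `offEntry i j ≤ 0` for all `i ≠ j`. -/
def OffNonpos {n : ℕ} (A α : Matrix (Fin n) (Fin n) ℝ) : Prop :=
  ∀ i j, i ≠ j → offEntry A α i j ≤ 0

/-- `offEntry i j ≲ 0` for all `i ≠ j` with `a_{ij} < 0`: the inequalities are strict, or they
are non-strict and `A⁽²⁾` is irreducible. -/
def OffLesssim {n : ℕ} (A α : Matrix (Fin n) (Fin n) ℝ) : Prop :=
  (∀ i j, i ≠ j → A i j < 0 → offEntry A α i j < 0) ∨
    ((∀ i j, i ≠ j → A i j < 0 → offEntry A α i j ≤ 0) ∧ IsIrreducibleMatrix (A₂ A α))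

/-! From here on the size is `n = m + 1`; the indices `1, …, n` are `0, …, Fin.last m`, and
`k ∈ {1, …, n - 1}` together with `k + 1` is `k.castSucc`, `k.succ` for `k : Fin m`. -/

/-- Nine alternatives on the whole matrix, used for `γ = 1` with `OffLesssim`. -/
def GlobalCond {m : ℕ} (A α : Matrix (Fin (m + 1)) (Fin (m + 1)) ℝ) : Prop :=
  (∃ i j, 0 < delta₂ A α 1 i j) ∨
  (A (Fin.last m) 0 < 0 ∧ 0 < α (Fin.last m) 0) ∨
  (∃ k : Fin m, A k.castSucc k.succ < 0 ∧ 0 < α k.castSucc k.succ) ∨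
  (∃ i j, 0 < α i j * A i j * A j i) ∨
  (∃ i j, i < Fin.last m ∧ j ≤ i ∧ 0 < α i (Fin.last m) * A i (Fin.last m) * A (Fin.last m) j) ∨
  (∃ i j, i < j ∧ 0 < α i j * A i j * A j 0) ∨
  (∃ i, ∃ j : Fin m, 0 < α i j.castSucc * A i j.castSucc * A j.castSucc j.succ) ∨
  (∃ i j, 0 < j ∧ j ≤ i ∧ 0 < α i 0 * A i 0 * A 0 j) ∨
  (A (Fin.last m) 0 < 0 ∧ ∀ k : Fin m, A k.castSucc k.succ < 0)

/-- The first six alternatives on row `i`. -/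
def RowCondSix {m : ℕ} (A α : Matrix (Fin (m + 1)) (Fin (m + 1)) ℝ) (i : Fin (m + 1)) : Prop :=
  (∃ j, 0 < delta₂ A α 1 i j) ∨
  (∃ k : Fin m, k.castSucc = i ∧ A i k.succ < 0 ∧ 0 < α i k.succ) ∨
  (∃ j, 0 < α i j * A i j * A j i) ∨
  (∃ j, j ≤ i ∧ 0 < α i (Fin.last m) * A i (Fin.last m) * A (Fin.last m) j) ∨
  (∃ j, i < j ∧ 0 < α i j * A i j * A j 0) ∨
  (∃ j : Fin m, 0 < α i j.castSucc * A i j.castSucc * A j.castSucc j.succ)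

/-- All seven alternatives on row `i`. -/
def RowCondSeven {m : ℕ} (A α : Matrix (Fin (m + 1)) (Fin (m + 1)) ℝ) (i : Fin (m + 1)) : Prop :=
  RowCondSix A α i ∨ ∃ j, 0 < j ∧ j ≤ i ∧ 0 < α i 0 * A i 0 * A 0 j

/-- Five alternatives involving the last row. -/
def LastRowCond {m : ℕ} (A α : Matrix (Fin (m + 1)) (Fin (m + 1)) ℝ) : Prop :=
  (∃ j k, k < j ∧ 0 < α (Fin.last m) k * A (Fin.last m) k * A k j) ∨
  (A (Fin.last m) 0 < 0 ∧ 0 < α (Fin.last m) 0) ∨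
  (∃ j, 0 < j ∧ j < Fin.last m ∧ offEntry A α (Fin.last m) j < 0) ∨
  (RowCondSix A α 0 ∧ offEntry A α (Fin.last m) 0 < 0) ∨
  (RowCondSix A α 0 ∧ A (Fin.last m) 0 < 0)

/-- The four alternative conditions for the Stein–Rosenberg type comparison with `Q₂`. -/
def SteinRosenbergCond {m : ℕ} (A α : Matrix (Fin (m + 1)) (Fin (m + 1)) ℝ) (γ : ℝ) : Prop :=
  (γ < 1 ∧ OffLesssim A α) ∨
  (γ = 1 ∧ OffLesssim A α ∧ GlobalCond A α) ∨
  (γ < 1 ∧ OffNonpos A α ∧ ∀ i, i < Fin.last m → ∃ j, α i j * A i j < 0) ∨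
  (γ = 1 ∧ OffNonpos A α ∧ (∀ i, 0 < i → i < Fin.last m → RowCondSeven A α i) ∧
    LastRowCond A α)

/-- The condition that compares the lower triangular parts of `A` and `A⁽²⁾`. -/
def LowerCond {n : ℕ} (A α : Matrix (Fin n) (Fin n) ℝ) (γ : ℝ) : Prop :=
  OffNonpos A α ∧ (∀ i j, j < i → 0 ≤ lowerGap A α i j) ∧
    ((∃ i, 0 < diagGap A α i) ∨ (0 < γ ∧ ∃ i j, j < i ∧ 0 < lowerGap A α i j))

end

end PrecAOR

/-! Write M = D - γL (`aorM`) and N = (1-γ)L + U (`aorN`). A matrix is then M - N and its AOR matrix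
is (1-ω)I + ωM⁻¹N, so only M⁻¹N has to be compared. Irreducibility of A gives x > 0 and 0 < r < 1
with Nx = rMx, hence Ax = (1-r)Mx (`exists_pos_perron_aorMatrix`). Let M₂, N₂ be the splitting of
A⁽²⁾, let y ≥ 0 be a left Perron vector of M₂⁻¹N₂ with eigenvalue r₂, and z = yM₂⁻¹ ≥ 0. Computing
zA⁽²⁾x in two ways gives (r - r₂) y·x = (1-r) z·Ex, where E = (I+Q₂)M - M₂ (`aorResidual`).

Since Ex ≥ 0 and y·x > 0, r₂ ≤ r, and equality forces Ex to vanish on S = {i | z i > 0}. The graph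
of A⁽²⁾ has no edge leaving S, and each element of S receives an edge from another element of S
(`rho_lt_or_exists_stationary`). The rest excludes such an S.

A zero of Ex in row i with some nonzero Q₂ i k forces γ = 1 and a pattern of zeros in row k of A
(`pattern_of_aorResidual_mulVec_eq_zero`). If γ < 1, the rows of Q₂ in S therefore vanish, S is
closed for A as well, hence is everything, and Q₂ = 0, which is impossible. If γ = 1, condition 2
makes S everything, condition 4 makes S consist of the first and last index, and condition 5 is
refuted by splitting E into two nonnegative parts; each contradicts the pattern or the vanishing of
Ex. -/

namespace PrecAOR

open Filter Topology Matrix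

/-! ### Weak Perron–Frobenius theory for nonnegative matrices. -/

section PerronFrobenius

variable {ι : Type*} [Fintype ι]

theorem mulVec_nonneg_of_nonneg {T : Matrix ι ι ℝ} (hT : ∀ i j, 0 ≤ T i j) {u : ι → ℝ}
    (hu : ∀ i, 0 ≤ u i) (i : ι) : 0 ≤ (T *ᵥ u) i :=
  Finset.sum_nonneg fun j _ => mul_nonneg (hT i j) (hu j)

theorem mulVec_pos_of_pos {T : Matrix ι ι ℝ} (hT : ∀ i j, 0 < T i j) {u : ι → ℝ}
    (hu : ∀ i, 0 ≤ u i) (hu' : u ≠ 0) (i : ι) : 0 < (T *ᵥ u) i := by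
  obtain ⟨j, hj⟩ := Function.ne_iff.mp hu'
  exact Finset.sum_pos' (fun j _ => mul_nonneg (hT i j).le (hu j))
    ⟨j, Finset.mem_univ _, mul_pos (hT i j) (lt_of_le_of_ne (hu j) (Ne.symm hj))⟩

/-- A subinvariant vector can be rescaled into the standard simplex. -/
theorem exists_mem_stdSimplex_of_smul_le {T : Matrix ι ι ℝ} {t : ℝ} {u : ι → ℝ}
    (hu : ∀ i, 0 ≤ u i) (hu' : u ≠ 0) (h : ∀ i, t * u i ≤ (T *ᵥ u) i) :
    ∃ w ∈ stdSimplex ℝ ι, ∀ i, t * w i ≤ (T *ᵥ w) i := by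
  obtain ⟨j, hj⟩ := Function.ne_iff.mp hu'
  have hs : 0 < ∑ i, u i := Finset.sum_pos' (fun j _ => hu j)
    ⟨j, Finset.mem_univ _, lt_of_le_of_ne (hu j) (Ne.symm hj)⟩
  refine ⟨(∑ i, u i)⁻¹ • u, ⟨fun i => mul_nonneg (inv_nonneg.2 hs.le) (hu i), ?_⟩, fun i => ?_⟩
  · simp only [Pi.smul_apply, smul_eq_mul, ← Finset.mul_sum]
    exact inv_mul_cancel₀ hs.ne'
  · rw [Matrix.mulVec_smul]
    simp only [Pi.smul_apply, smul_eq_mul]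
    have := mul_le_mul_of_nonneg_left (h i) (inv_nonneg.2 hs.le)
    linarith

theorem ne_zero_of_mem_stdSimplex {w : ι → ℝ} (hw : w ∈ stdSimplex ℝ ι) : w ≠ 0 := by
  rintro rfl
  simpa using hw.2

/-- A Collatz–Wielandt value is at most the sum of the entries. -/
theorem collatzWielandt_le_sum {T : Matrix ι ι ℝ} (hT : ∀ i j, 0 ≤ T i j) {t : ℝ} {w : ι → ℝ}
    (hw : w ∈ stdSimplex ℝ ι) (h : ∀ i, t * w i ≤ (T *ᵥ w) i) : t ≤ ∑ i, ∑ j, T i j := by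
  calc t = ∑ i, t * w i := by rw [← Finset.mul_sum, hw.2, mul_one]
    _ ≤ ∑ i, (T *ᵥ w) i := Finset.sum_le_sum fun i _ => h i
    _ ≤ ∑ i, ∑ j, T i j := by
      refine Finset.sum_le_sum fun i _ => Finset.sum_le_sum fun j _ => ?_
      have : w j ≤ 1 := hw.2 ▸ Finset.single_le_sum (fun k _ => hw.1 k) (Finset.mem_univ j)
      exact mul_le_of_le_one_right (hT i j) this

/-- Perron's theorem for a positive matrix, with the Collatz–Wielandt characterization. -/
theorem exists_perron_of_pos [Nonempty ι] {T : Matrix ι ι ℝ} (hT : ∀ i j, 0 < T i j) :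
    ∃ r : ℝ, 0 ≤ r ∧ ∃ w ∈ stdSimplex ℝ ι, T *ᵥ w = r • w ∧
      ∀ (t : ℝ) (u : ι → ℝ), (∀ i, 0 ≤ u i) → u ≠ 0 → (∀ i, t * u i ≤ (T *ᵥ u) i) → t ≤ r := by
  classical
  have hT0 : ∀ i j, 0 ≤ T i j := fun i j => (hT i j).le
  set C := ∑ i, ∑ j, T i j
  have hC : 0 ≤ C := Finset.sum_nonneg fun i _ => Finset.sum_nonneg fun j _ => hT0 i j
  -- Pairs (t, w) with t w ≤ T w on the simplex; values are bounded by the entry sum C, so K is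
  -- compact and a largest t exists.
  set K : Set (ℝ × (ι → ℝ)) :=
    (Set.Icc 0 C ×ˢ stdSimplex ℝ ι) ∩ {p | ∀ i, p.1 * p.2 i ≤ (T *ᵥ p.2) i} with hK
  have hKc : IsCompact K := by
    refine (isCompact_Icc.prod (isCompact_stdSimplex ℝ ι)).inter_right ?_
    rw [Set.ofPred_forall]
    refine isClosed_iInter fun i => isClosed_le (by fun_prop) ?_
    exact (continuous_apply i).comp (Continuous.matrix_mulVec continuous_const continuous_snd)
  have hKne : K.Nonempty := by
    obtain ⟨i₀⟩ := ‹Nonempty ι›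
    refine ⟨(0, Pi.single i₀ 1), ⟨⟨le_rfl, hC⟩, single_mem_stdSimplex ℝ i₀⟩, fun i => ?_⟩
    simp only [zero_mul]
    exact mulVec_nonneg_of_nonneg hT0 (single_mem_stdSimplex ℝ i₀).1 i
  obtain ⟨⟨r, w⟩, ⟨⟨hr, hw⟩, hrw⟩, hmax⟩ := hKc.exists_isMaxOn hKne continuous_fst.continuousOn
  simp only at hr hw
  have hrw' : ∀ i, r * w i ≤ (T *ᵥ w) i := hrw
  have key : ∀ (t : ℝ) (u : ι → ℝ), (∀ i, 0 ≤ u i) → u ≠ 0 →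
      (∀ i, t * u i ≤ (T *ᵥ u) i) → t ≤ r := by
    intro t u hu hu' h
    rcases le_or_gt t 0 with h0 | h0
    · exact h0.trans hr.1
    obtain ⟨v, hv, hv'⟩ := exists_mem_stdSimplex_of_smul_le hu hu' h
    exact hmax (a := (t, v)) ⟨⟨⟨h0.le, collatzWielandt_le_sum hT0 hv hv'⟩, hv⟩, hv'⟩
  refine ⟨r, hr.1, w, hw, ?_, key⟩
  -- If the defect Tw - rw is nonzero, positivity of T makes T(Tw - rw) strictly positive, so Tw
  -- admits a value r + ε, against maximality.
  by_contra hne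
  have hd0 : ∀ i, 0 ≤ (T *ᵥ w - r • w) i := fun i => sub_nonneg.2 (hrw' i)
  have hd : ∀ i, 0 < (T *ᵥ (T *ᵥ w - r • w)) i :=
    mulVec_pos_of_pos hT hd0 (sub_ne_zero.2 hne)
  have hTw : ∀ i, 0 < (T *ᵥ w) i := mulVec_pos_of_pos hT hw.1 (ne_zero_of_mem_stdSimplex hw)
  obtain ⟨i₀, -, hi₀⟩ := Finset.exists_min_image Finset.univ
    (fun i => (T *ᵥ (T *ᵥ w - r • w)) i / (T *ᵥ w) i) Finset.univ_nonempty
  set ε := (T *ᵥ (T *ᵥ w - r • w)) i₀ / (T *ᵥ w) i₀ with hε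
  have hεpos : 0 < ε := div_pos (hd i₀) (hTw i₀)
  have := key (r + ε) (T *ᵥ w) (fun i => (hTw i).le)
    (fun h0 => (hTw i₀).ne' (congrFun h0 i₀)) fun i => by
      have h1 := hi₀ i (Finset.mem_univ i)
      rw [le_div_iff₀ (hTw i)] at h1
      rw [Matrix.mulVec_sub, Matrix.mulVec_smul] at h1
      simp only [Pi.sub_apply, Pi.smul_apply, smul_eq_mul] at h1
      linarith
  linarith

/-- The moduli of a complex eigenvector are subinvariant for the modulus of the eigenvalue. -/
theorem exists_norm_mul_le_of_mem_spectrum [DecidableEq ι] {T : Matrix ι ι ℝ}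
    (hT : ∀ i j, 0 ≤ T i j)
    {z : ℂ} (hz : z ∈ spectrum ℂ (T.map (fun x : ℝ => (x : ℂ)))) :
    ∃ u : ι → ℝ, (∀ i, 0 ≤ u i) ∧ u ≠ 0 ∧ ∀ i, ‖z‖ * u i ≤ (T *ᵥ u) i := by
  rw [spectrum.mem_iff, Matrix.isUnit_iff_isUnit_det, isUnit_iff_ne_zero, not_not] at hz
  obtain ⟨v, hv, hv'⟩ := Matrix.exists_mulVec_eq_zero_iff.2 hz
  refine ⟨fun i => ‖v i‖, fun i => norm_nonneg _, ?_, fun i => ?_⟩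
  · obtain ⟨j, hj⟩ := Function.ne_iff.mp hv
    exact fun h => hj (norm_eq_zero.1 (congrFun h j))
  · rw [Matrix.sub_mulVec, sub_eq_zero, Algebra.algebraMap_eq_smul_one, Matrix.smul_mulVec,
      Matrix.one_mulVec] at hv'
    have h := congrFun hv' i
    simp only [Pi.smul_apply, smul_eq_mul] at h
    rw [← norm_mul, h]
    refine (norm_sum_le _ _).trans (le_of_eq ?_)
    refine Finset.sum_congr rfl fun j _ => ?_
    simp [abs_of_nonneg (hT i j)]

/-- Weak Perron–Frobenius theorem: the spectral radius of a nonnegative matrix is an eigenvalue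
with a nonnegative eigenvector. -/
theorem exists_perron_of_nonneg [Nonempty ι] [DecidableEq ι] {T : Matrix ι ι ℝ}
    (hT : ∀ i j, 0 ≤ T i j) :
    ∃ r : ℝ, 0 ≤ r ∧ spectralRadius ℂ (T.map (fun x : ℝ => (x : ℂ))) = ENNReal.ofReal r ∧
      ∃ w : ι → ℝ, (∀ i, 0 ≤ w i) ∧ w ≠ 0 ∧ T *ᵥ w = r • w := by
  -- The positive matrices T + J/(k+1) have Perron pairs in a fixed compact set; a limit point is
  -- the required pair for T.
  set J : Matrix ι ι ℝ := Matrix.of fun _ _ => 1 with hJ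
  have hε : ∀ k : ℕ, (0 : ℝ) < 1 / ((k : ℝ) + 1) := fun k => Nat.one_div_pos_of_nat
  have hε1 : ∀ k : ℕ, 1 / ((k : ℝ) + 1) ≤ 1 := fun k => by
    rw [div_le_one (by positivity)]; linarith [k.cast_nonneg (α := ℝ)]
  have hpos : ∀ (k : ℕ) i j, 0 < (T + (1 / ((k : ℝ) + 1)) • J) i j := fun k i j => by
    have := hε k
    simp only [hJ, Matrix.add_apply, Matrix.smul_apply, Matrix.of_apply, smul_eq_mul, mul_one]
    linarith [hT i j]
  choose r hr w hw hrw hmax using fun k => exists_perron_of_pos (hpos k)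
  set C := ∑ i, ∑ j, (T + J) i j
  have hrC : ∀ k, r k ≤ C := fun k => by
    refine (collatzWielandt_le_sum (fun i j => (hpos k i j).le) (hw k)
      (fun i => (congrFun (hrw k) i).ge)).trans ?_
    refine Finset.sum_le_sum fun i _ => Finset.sum_le_sum fun j _ => ?_
    simp only [hJ, Matrix.add_apply, Matrix.smul_apply, Matrix.of_apply, smul_eq_mul, mul_one]
    linarith [hε1 k]
  obtain ⟨⟨s, x⟩, ⟨hs, hx⟩, φ, hφ, hlim⟩ :=
    (isCompact_Icc.prod (isCompact_stdSimplex ℝ ι)).tendsto_subseq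
      (x := fun k => (r k, w k)) (fun k => ⟨⟨hr k, hrC k⟩, hw k⟩)
  have hls : Tendsto (fun k => r (φ k)) atTop (𝓝 s) := (continuous_fst.tendsto _).comp hlim
  have hlx : Tendsto (fun k => w (φ k)) atTop (𝓝 x) := (continuous_snd.tendsto _).comp hlim
  have hle : Tendsto (fun k => 1 / ((φ k : ℝ) + 1)) atTop (𝓝 0) :=
    (tendsto_one_div_add_atTop_nhds_zero_nat (𝕜 := ℝ)).comp hφ.tendsto_atTop
  have hTx : T *ᵥ x = s • x := by
    have h1 : Tendsto (fun k => T *ᵥ w (φ k) + (1 / ((φ k : ℝ) + 1)) • (J *ᵥ w (φ k))) atTop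
        (𝓝 (T *ᵥ x + (0 : ℝ) • (J *ᵥ x))) :=
      (((Continuous.matrix_mulVec continuous_const continuous_id).tendsto x).comp hlx).add
        (hle.smul (((Continuous.matrix_mulVec continuous_const continuous_id).tendsto x).comp hlx))
    have h2 : Tendsto (fun k => r (φ k) • w (φ k)) atTop (𝓝 (s • x)) := hls.smul hlx
    have h3 : (fun k => T *ᵥ w (φ k) + (1 / ((φ k : ℝ) + 1)) • (J *ᵥ w (φ k))) =
        fun k => r (φ k) • w (φ k) := by
      funext k
      rw [← hrw, Matrix.add_mulVec, Matrix.smul_mulVec]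
    rw [h3] at h1
    simpa using tendsto_nhds_unique h1 h2
  have hx0 : x ≠ 0 := ne_zero_of_mem_stdSimplex hx
  refine ⟨s, hs.1, le_antisymm ?_ ?_, x, hx.1, hx0, hTx⟩
  · refine iSup₂_le fun z hz => ?_
    obtain ⟨u, hu, hu0, hzu⟩ := exists_norm_mul_le_of_mem_spectrum hT hz
    -- Subinvariance of the moduli survives the perturbation, which only enlarges the entries.
    have hz : ∀ k, ‖z‖ ≤ r k := fun k => by
      refine hmax k _ u hu hu0 fun i => (hzu i).trans ?_
      refine Finset.sum_le_sum fun j _ => mul_le_mul_of_nonneg_right ?_ (hu j)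
      simp only [hJ, Matrix.add_apply, Matrix.smul_apply, Matrix.of_apply, smul_eq_mul, mul_one]
      linarith [hε k]
    have : ‖z‖ ≤ s := ge_of_tendsto' hls fun k => hz (φ k)
    rw [← enorm_eq_nnnorm, ← ofReal_norm]
    exact ENNReal.ofReal_le_ofReal this
  · have hmem : (s : ℂ) ∈ spectrum ℂ (T.map (fun x : ℝ => (x : ℂ))) := by
      rw [spectrum.mem_iff, Matrix.isUnit_iff_isUnit_det, isUnit_iff_ne_zero, not_not]
      refine Matrix.exists_mulVec_eq_zero_iff.1 ⟨fun i => (x i : ℂ), ?_, ?_⟩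
      · obtain ⟨j, hj⟩ := Function.ne_iff.mp hx0
        exact fun h => hj (by simpa using congrFun h j)
      · rw [Matrix.sub_mulVec, sub_eq_zero, Algebra.algebraMap_eq_smul_one, Matrix.smul_mulVec,
          Matrix.one_mulVec]
        funext i
        have h := congrFun hTx i
        simp only [Matrix.mulVec, dotProduct, Pi.smul_apply, smul_eq_mul, Matrix.map_apply] at h ⊢
        exact_mod_cast h.symm
    refine le_trans (le_of_eq ?_) (le_iSup₂ (f := fun (k : ℂ) (_ : k ∈ spectrum ℂ
      (T.map (fun x : ℝ => (x : ℂ)))) => (‖k‖₊ : ENNReal)) (s : ℂ) hmem)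
    rw [← enorm_eq_nnnorm, ← ofReal_norm, Complex.norm_real, Real.norm_of_nonneg hs.1]

/-- Ensures that the left Perron vector, obtained from the transpose, belongs to the same eigenvalue
as the right one. -/
theorem spectrum_transpose [DecidableEq ι] (T : Matrix ι ι ℂ) :
    spectrum ℂ Tᵀ = spectrum ℂ T := by
  ext z
  rw [spectrum.mem_iff, spectrum.mem_iff, Matrix.isUnit_iff_isUnit_det,
    Matrix.isUnit_iff_isUnit_det (_ - T), ← Matrix.det_transpose (_ - T), Matrix.transpose_sub,
    Algebra.algebraMap_eq_smul_one, Matrix.transpose_smul, Matrix.transpose_one]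

end PerronFrobenius

/-- A nonnegative matrix has nonnegative right and left eigenvectors for its spectral radius. -/
theorem exists_right_left_perron {n : ℕ} [NeZero n] {T : Matrix (Fin n) (Fin n) ℝ}
    (hT : ∀ i j, 0 ≤ T i j) :
    ∃ r : ℝ, 0 ≤ r ∧ rho T = ENNReal.ofReal r ∧
      (∃ w : Fin n → ℝ, (∀ i, 0 ≤ w i) ∧ w ≠ 0 ∧ T *ᵥ w = r • w) ∧
      ∃ y : Fin n → ℝ, (∀ i, 0 ≤ y i) ∧ y ≠ 0 ∧ y ᵥ* T = r • y := by
  obtain ⟨r, hr, hρ, hw⟩ := exists_perron_of_nonneg hT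
  obtain ⟨s, hs, hρ', hy⟩ := exists_perron_of_nonneg (T := Tᵀ) fun i j => hT j i
  have hsr : s = r := by
    rw [Matrix.transpose_map, spectralRadius, spectrum_transpose] at hρ'
    exact (ENNReal.ofReal_eq_ofReal_iff hs hr).1 (hρ'.symm.trans hρ)
  subst hsr
  refine ⟨s, hr, hρ, hw, ?_⟩
  obtain ⟨y, h0, h1, h2⟩ := hy
  exact ⟨y, h0, h1, by rwa [← Matrix.mulVec_transpose]⟩

end PrecAOR

namespace PrecAOR

open Matrix

/-! ### Irreducibility as absence of proper closed index sets. -/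

section Irreducible

variable {n : ℕ} {A : Matrix (Fin n) (Fin n) ℝ}

/-- A nonempty set of indices without outgoing edges is everything. -/
theorem eq_univ_of_isIrreducibleMatrix (hA : IsIrreducibleMatrix A) {S : Set (Fin n)}
    (hS : S.Nonempty) (hcl : ∀ i ∈ S, ∀ j, j ∉ S → A i j = 0) (j : Fin n) : j ∈ S := by
  classical
  by_contra hj
  refine hA ?_
  -- The permutation lists the complement of S first, so that the vanishing S × Sᶜ block lands in
  -- the lower left corner.
  set r := Fintype.card {i // i ∉ S} with hr
  have hr1 : 1 ≤ r := Fintype.card_pos_iff.2 ⟨⟨j, hj⟩⟩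
  obtain ⟨i₀, hi₀⟩ := hS
  have hrn : r < n := by
    have := Fintype.card_subtype_lt (p := fun i : Fin n => i ∉ S) (x := i₀) (not_not.2 hi₀)
    rwa [Fintype.card_fin] at this
  have hcard : Fintype.card {i : Fin n // (i : ℕ) < r} = Fintype.card {i // i ∉ S} := by
    rw [← hr]
    have e : {i : Fin n // (i : ℕ) < r} ≃ Fin r :=
      ⟨fun i => ⟨i.1, i.2⟩, fun i => ⟨⟨i, i.2.trans hrn⟩, i.2⟩, fun _ => rfl, fun _ => rfl⟩
    rw [Fintype.card_congr e, Fintype.card_fin]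
  let e := Fintype.equivOfCardEq hcard
  refine ⟨e.extendSubtype, r, hr1, hrn, fun i k hi hk => hcl _ ?_ _ ?_⟩
  · exact not_not.1 (e.extendSubtype_not_mem i (not_lt.2 hi))
  · exact e.extendSubtype_mem k hk

theorem exists_ne_apply_ne_zero_of_isIrreducibleMatrix (hA : IsIrreducibleMatrix A)
    (hn : 2 ≤ n) (i : Fin n) : ∃ j, j ≠ i ∧ A i j ≠ 0 := by
  by_contra! h
  have : Nontrivial (Fin n) := Fin.nontrivial_iff_two_le.2 hn
  obtain ⟨k, hk⟩ := exists_ne i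
  refine hk (eq_univ_of_isIrreducibleMatrix hA (S := {i}) ⟨i, rfl⟩ ?_ k)
  rintro _ rfl j hj
  exact h j hj

end Irreducible

/-! ### Z-matrices that are semipositive have nonnegative inverses. -/

section ZMatrix

variable {n : ℕ} {B : Matrix (Fin n) (Fin n) ℝ} {x : Fin n → ℝ}

theorem IsZMatrix.pos_of_mulVec_pos (hB : IsZMatrix B) (hx : ∀ i, 0 ≤ x i)
    (hBx : ∀ i, 0 < (B *ᵥ x) i) (i : Fin n) : 0 < B i i ∧ 0 < x i := by
  have h : (B *ᵥ x) i ≤ B i i * x i := by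
    rw [Matrix.mulVec, dotProduct, ← Finset.add_sum_erase _ _ (Finset.mem_univ i)]
    have : ∑ j ∈ Finset.univ.erase i, B i j * x j ≤ 0 := Finset.sum_nonpos fun j hj =>
      mul_nonpos_of_nonpos_of_nonneg (hB i j (Finset.ne_of_mem_erase hj).symm) (hx j)
    linarith
  have hp := (hBx i).trans_le h
  have hx0 : 0 < x i := lt_of_le_of_ne (hx i) fun h0 => by simp [← h0] at hp
  exact ⟨pos_of_mul_pos_left hp hx0.le, hx0⟩

/-- Minimum-ratio argument: if t = min y/x were negative, attained at k, then y ≥ t x with equality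
at k, and the off-diagonal signs give (By) k ≤ t (Bx) k < 0. -/
theorem IsZMatrix.nonneg_of_mulVec_nonneg (hB : IsZMatrix B) (hx : ∀ i, 0 ≤ x i)
    (hBx : ∀ i, 0 < (B *ᵥ x) i) {y : Fin n → ℝ} (hy : ∀ i, 0 ≤ (B *ᵥ y) i) (i : Fin n) :
    0 ≤ y i := by
  by_contra! hi
  have hxp : ∀ i, 0 < x i := fun i => (hB.pos_of_mulVec_pos hx hBx i).2
  obtain ⟨k, -, hk⟩ := Finset.exists_min_image Finset.univ (fun i => y i / x i)
    ⟨i, Finset.mem_univ i⟩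
  set t := y k / x k with ht
  have htneg : t < 0 := (hk i (Finset.mem_univ i)).trans_lt (div_neg_of_neg_of_pos hi (hxp i))
  have hty : ∀ j, t * x j ≤ y j := fun j => (le_div_iff₀ (hxp j)).1 (hk j (Finset.mem_univ j))
  have htk : t * x k = y k := div_mul_cancel₀ _ (hxp k).ne'
  have hle : (B *ᵥ y) k ≤ t * (B *ᵥ x) k := by
    rw [Matrix.mulVec, dotProduct, Matrix.mulVec, dotProduct, Finset.mul_sum]
    refine Finset.sum_le_sum fun j _ => ?_
    rcases eq_or_ne k j with rfl | hkj
    · rw [← htk]; apply le_of_eq; ring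
    · have := mul_le_mul_of_nonpos_left (hty j) (hB k j hkj)
      linarith
  linarith [hy k, mul_neg_of_neg_of_pos htneg (hBx k)]

theorem IsZMatrix.isUnit_of_mulVec_pos (hB : IsZMatrix B) (hx : ∀ i, 0 ≤ x i)
    (hBx : ∀ i, 0 < (B *ᵥ x) i) : IsUnit B := by
  rw [Matrix.isUnit_iff_isUnit_det, isUnit_iff_ne_zero]
  intro h
  obtain ⟨v, hv, hBv⟩ := Matrix.exists_mulVec_eq_zero_iff.2 h
  refine hv (funext fun i => le_antisymm ?_ ?_)
  · have := hB.nonneg_of_mulVec_nonneg hx hBx (y := -v)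
      (fun i => by rw [Matrix.mulVec_neg, hBv]; simp) i
    simpa using this
  · exact hB.nonneg_of_mulVec_nonneg hx hBx (fun i => by rw [hBv]; simp) i

theorem IsZMatrix.inv_nonneg_of_mulVec_pos (hB : IsZMatrix B) (hx : ∀ i, 0 ≤ x i)
    (hBx : ∀ i, 0 < (B *ᵥ x) i) (i j : Fin n) : 0 ≤ B⁻¹ i j := by
  have hdet := (Matrix.isUnit_iff_isUnit_det B).1 (hB.isUnit_of_mulVec_pos hx hBx)
  have := hB.nonneg_of_mulVec_nonneg hx hBx (y := B⁻¹ *ᵥ Pi.single j 1) (fun k => by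
    rw [Matrix.mulVec_mulVec, Matrix.mul_nonsing_inv _ hdet, Matrix.one_mulVec]
    by_cases h : k = j
    · subst h; simp
    · simp [Pi.single_eq_of_ne h]) i
  simpa using this

end ZMatrix

/-! ### The AOR splitting M - N and its signs. -/

section Splitting

variable {n : ℕ} {B : Matrix (Fin n) (Fin n) ℝ} {γ ω : ℝ}

/-- The matrix `(1 - γ) L + U`, so that `B = aorM γ B - aorN γ B`. -/
def aorN {n : ℕ} (γ : ℝ) (B : Matrix (Fin n) (Fin n) ℝ) : Matrix (Fin n) (Fin n) ℝ :=
  (1 - γ) • lowerPart B + upperPart B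

/-- The factor by which `aorM γ` multiplies the entry `(i, j)`. -/
def aorWeight {n : ℕ} (γ : ℝ) (i j : Fin n) : ℝ :=
  if i = j then 1 else if j < i then γ else 0

theorem aorWeight_self (i : Fin n) : aorWeight γ i i = 1 := if_pos rfl

theorem aorWeight_of_lt {i j : Fin n} (h : j < i) : aorWeight γ i j = γ := by
  rw [aorWeight, if_neg h.ne', if_pos h]

theorem aorWeight_of_gt {i j : Fin n} (h : i < j) : aorWeight γ i j = 0 := by
  rw [aorWeight, if_neg h.ne, if_neg h.not_gt]

theorem aorWeight_nonneg (hγ : 0 ≤ γ) (i j : Fin n) : 0 ≤ aorWeight γ i j := by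
  unfold aorWeight; split_ifs <;> simp [hγ]

theorem aorWeight_le_one (hγ : γ ≤ 1) (i j : Fin n) : aorWeight γ i j ≤ 1 := by
  unfold aorWeight; split_ifs <;> simp [hγ]

theorem aorM_apply (i j : Fin n) : aorM γ B i j = aorWeight γ i j * B i j := by
  simp only [aorM, diagPart, lowerPart, aorWeight, Matrix.sub_apply, Matrix.smul_apply,
    Matrix.of_apply, smul_eq_mul]
  rcases lt_trichotomy i j with h | rfl | h
  · rw [Matrix.diagonal_apply_ne _ h.ne]; simp [h.ne, h.not_gt]
  · simp
  · rw [Matrix.diagonal_apply_ne _ h.ne']; simp [h.ne', h]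

theorem aorM_sub_aorN : aorM γ B - aorN γ B = B := by
  ext i j
  rw [Matrix.sub_apply, aorM_apply]
  simp only [aorN, lowerPart, upperPart, Matrix.add_apply, Matrix.smul_apply, Matrix.of_apply,
    smul_eq_mul]
  rcases lt_trichotomy i j with h | rfl | h
  · simp [aorWeight_of_gt h, h, h.not_gt]
  · simp [aorWeight_self]
  · simp only [aorWeight_of_lt h, h, h.not_gt, if_true, if_false]; ring

theorem aorN_apply (i j : Fin n) : aorN γ B i j = (aorWeight γ i j - 1) * B i j := by
  have := congrFun (congrFun (aorM_sub_aorN (γ := γ) (B := B)) i) j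
  rw [Matrix.sub_apply, aorM_apply] at this
  linarith

theorem aorN_nonneg (hγ₁ : γ ≤ 1) (hB : IsZMatrix B) (i j : Fin n) : 0 ≤ aorN γ B i j := by
  rw [aorN_apply]
  rcases eq_or_ne i j with rfl | h
  · simp [aorWeight_self]
  · exact mul_nonneg_of_nonpos_of_nonpos (by linarith [aorWeight_le_one hγ₁ i j]) (hB i j h)

theorem isZMatrix_aorM (hγ₀ : 0 ≤ γ) (hB : IsZMatrix B) : IsZMatrix (aorM γ B) := fun i j h => by
  rw [aorM_apply]
  exact mul_nonpos_of_nonneg_of_nonpos (aorWeight_nonneg hγ₀ i j) (hB i j h)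

/-- M = B + N with N ≥ 0, so M inherits semipositivity from B, and with it invertibility and a
nonnegative inverse. -/
theorem aorM_mulVec_pos (hγ₁ : γ ≤ 1) (hB : IsZMatrix B) {x : Fin n → ℝ} (hx : ∀ i, 0 ≤ x i)
    (hBx : ∀ i, 0 < (B *ᵥ x) i) (i : Fin n) : 0 < (aorM γ B *ᵥ x) i := by
  have h1 : aorM γ B *ᵥ x = B *ᵥ x + aorN γ B *ᵥ x := by
    rw [← Matrix.add_mulVec]
    congr 1
    exact sub_eq_iff_eq_add.1 aorM_sub_aorN
  rw [h1]
  exact add_pos_of_pos_of_nonneg (hBx i) (mulVec_nonneg_of_nonneg (aorN_nonneg hγ₁ hB) hx i)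

/-- The parameter ω only shifts and scales M⁻¹N, so it plays no part in the comparison beyond 0 < ω
≤ 1. -/
theorem aorMatrix_eq (h : IsUnit (aorM γ B)) :
    aorMatrix γ ω B = (1 - ω) • (1 : Matrix (Fin n) (Fin n) ℝ) +
      ω • ((aorM γ B)⁻¹ * aorN γ B) := by
  have hdet := (Matrix.isUnit_iff_isUnit_det _).1 h
  have h1 : (1 - ω) • diagPart B + (ω - γ) • lowerPart B + ω • upperPart B =
      (1 - ω) • aorM γ B + ω • aorN γ B := by
    simp only [aorM, aorN]
    module
  rw [aorMatrix, h1, Matrix.mul_add, Matrix.mul_smul, Matrix.mul_smul,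
    Matrix.nonsing_inv_mul _ hdet]

theorem mul_entries_nonneg {X Y : Matrix (Fin n) (Fin n) ℝ} (hX : ∀ i j, 0 ≤ X i j)
    (hY : ∀ i j, 0 ≤ Y i j) (i j : Fin n) : 0 ≤ (X * Y) i j := by
  rw [Matrix.mul_apply]
  exact Finset.sum_nonneg fun k _ => mul_nonneg (hX i k) (hY k j)

theorem aorMatrix_nonneg (hω₀ : 0 < ω) (hω₁ : ω ≤ 1) (hγ₁ : γ ≤ 1) (hB : IsZMatrix B)
    (h : IsUnit (aorM γ B)) (hinv : ∀ i j, 0 ≤ (aorM γ B)⁻¹ i j) (i j : Fin n) :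
    0 ≤ aorMatrix γ ω B i j := by
  rw [aorMatrix_eq h, Matrix.add_apply, Matrix.smul_apply, Matrix.smul_apply, smul_eq_mul,
    smul_eq_mul]
  have h1 := mul_entries_nonneg hinv (aorN_nonneg hγ₁ hB) i j
  have h2 : 0 ≤ (1 : Matrix (Fin n) (Fin n) ℝ) i j := by
    rw [Matrix.one_apply]; split_ifs <;> norm_num
  have h3 : 0 ≤ 1 - ω := by linarith
  positivity

end Splitting

end PrecAOR

namespace PrecAOR

open Matrix

/-! ### Entries of the preconditioned matrix and sign of the residual. -/

section Preconditioned

variable {n : ℕ} {A α : Matrix (Fin n) (Fin n) ℝ} {γ ω : ℝ}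

theorem Q₂_apply (i j : Fin n) : Q₂ A α i j = -(α i j * A i j) := rfl

theorem Q₂_self (hα : IsAdmissible A α) (i : Fin n) : Q₂ A α i i = 0 := by
  rw [Q₂_apply, hα.1, zero_mul, neg_zero]

theorem Q₂_nonneg (hA : IsZMatrix A) (hα : IsAdmissible A α) (i j : Fin n) : 0 ≤ Q₂ A α i j := by
  rcases eq_or_ne i j with rfl | h
  · rw [Q₂_self hα]
  · rw [Q₂_apply]
    exact neg_nonneg.2 (mul_nonpos_of_nonneg_of_nonpos (hα.2.1 i j h) (hA i j h))

theorem exists_Q₂_ne_zero (hα : IsAdmissible A α) : ∃ i j, i ≠ j ∧ Q₂ A α i j ≠ 0 := by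
  by_contra! h
  refine hα.2.2 (Finset.sum_eq_zero fun i _ => Finset.sum_eq_zero fun j hj => ?_)
  exact neg_eq_zero.1 (h i j (Finset.mem_filter.1 hj).2.symm)

theorem A₂_apply (i j : Fin n) : A₂ A α i j = A i j + ∑ k, Q₂ A α i k * A k j := by
  rw [A₂, Matrix.add_mul, Matrix.one_mul, Matrix.add_apply, Matrix.mul_apply]

theorem A₂_apply_of_ne (hdiag : ∀ i, A i i = 1) (hα : IsAdmissible A α) {i j : Fin n}
    (hij : i ≠ j) :
    A₂ A α i j = A i j + Q₂ A α i j + ∑ k with k ≠ i ∧ k ≠ j, Q₂ A α i k * A k j := by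
  have h1 : ∑ k with ¬(k ≠ i ∧ k ≠ j), Q₂ A α i k * A k j = Q₂ A α i j := by
    have : (Finset.univ.filter fun k => ¬(k ≠ i ∧ k ≠ j)) = {i, j} := by
      ext k; simp; tauto
    rw [this, Finset.sum_pair hij, Q₂_self hα, hdiag]; ring
  rw [A₂_apply, ← Finset.sum_filter_add_sum_filter_not _ (fun k => k ≠ i ∧ k ≠ j), h1]
  ring

theorem A₂_eq_offEntry (hdiag : ∀ i, A i i = 1) (hα : IsAdmissible A α) {i j : Fin n}
    (hij : i ≠ j) : A₂ A α i j = offEntry A α i j := by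
  rw [A₂_apply_of_ne hdiag hα hij, offEntry, Q₂_apply]
  simp only [Q₂_apply, neg_mul, Finset.sum_neg_distrib]
  ring

theorem A₂_eq_sub_lowerGap (hdiag : ∀ i, A i i = 1) (hα : IsAdmissible A α) {i j : Fin n}
    (hij : i ≠ j) : A₂ A α i j = A i j - lowerGap A α i j := by
  rw [A₂_eq_offEntry hdiag hα hij, offEntry, lowerGap]
  ring

theorem A₂_self (hα : IsAdmissible A α) (i : Fin n) :
    A₂ A α i i = A i i - diagGap A α i := by
  have h1 : ∑ k with ¬(k ≠ i), Q₂ A α i k * A k i = 0 := by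
    refine Finset.sum_eq_zero fun k hk => ?_
    rw [not_not.1 (Finset.mem_filter.1 hk).2, Q₂_self hα, zero_mul]
  rw [A₂_apply, ← Finset.sum_filter_add_sum_filter_not _ (fun k => k ≠ i), h1, diagGap]
  simp only [Q₂_apply, neg_mul, Finset.sum_neg_distrib]
  ring

theorem isZMatrix_A₂ (hdiag : ∀ i, A i i = 1) (hα : IsAdmissible A α) (hoff : OffNonpos A α) :
    IsZMatrix (A₂ A α) := fun i j h => by
  rw [A₂_eq_offEntry hdiag hα h]
  exact hoff i j h

/-- The matrix `(I + Q₂) M - M₂`, where `M` and `M₂` are the AOR splitting matrices of `A` and of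
the preconditioned matrix. -/
def aorResidual {n : ℕ} (γ : ℝ) (A α : Matrix (Fin n) (Fin n) ℝ) : Matrix (Fin n) (Fin n) ℝ :=
  (1 + Q₂ A α) * aorM γ A - aorM γ (A₂ A α)

theorem aorResidual_mulVec_eq_add (x : Fin n → ℝ) :
    aorResidual γ A α *ᵥ x =
      Q₂ A α *ᵥ (aorM γ A *ᵥ x) + (aorM γ A - aorM γ (A₂ A α)) *ᵥ x := by
  rw [aorResidual, Matrix.mulVec_mulVec, ← Matrix.add_mulVec]
  congr 1
  noncomm_ring

/-- The terms with A i j cancel. What remains weighs row k of A once by the weights of row k and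
once by those of row i, so the sign can be read off for each k separately. -/
theorem aorResidual_mulVec (x : Fin n → ℝ) (i : Fin n) :
    (aorResidual γ A α *ᵥ x) i =
      ∑ k, Q₂ A α i k * ((aorM γ A *ᵥ x) k - ∑ j, aorWeight γ i j * A k j * x j) := by
  have h2 : ((aorM γ A - aorM γ (A₂ A α)) *ᵥ x) i =
      -∑ k, Q₂ A α i k * ∑ j, aorWeight γ i j * A k j * x j := by
    simp only [Matrix.mulVec, dotProduct, Matrix.sub_apply, aorM_apply, A₂_apply, Finset.mul_sum]
    rw [Finset.sum_comm, ← Finset.sum_neg_distrib]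
    refine Finset.sum_congr rfl fun j _ => ?_
    rw [mul_add, sub_add_cancel_left, Finset.mul_sum, neg_mul, Finset.sum_mul]
    congr 1
    exact Finset.sum_congr rfl fun k _ => by ring
  rw [aorResidual_mulVec_eq_add, Pi.add_apply, h2]
  simp only [mul_sub, Finset.sum_sub_distrib]
  rfl

/-- The weights of row i live on j ≤ i < k, hence miss the diagonal entry of row k; the subtracted
sum is nonpositive. -/
theorem residualTerm_of_lt (hA : IsZMatrix A) (hγ₀ : 0 ≤ γ)
    {x : Fin n → ℝ} (hx : ∀ i, 0 < x i) {i k : Fin n} (hik : i < k)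
    (hMx : 0 ≤ (aorM γ A *ᵥ x) k) :
    0 ≤ (aorM γ A *ᵥ x) k - ∑ j, aorWeight γ i j * A k j * x j ∧
      ((aorM γ A *ᵥ x) k - ∑ j, aorWeight γ i j * A k j * x j = 0 →
        (aorM γ A *ᵥ x) k = 0 ∧ ∀ j, aorWeight γ i j * A k j = 0) := by
  have hterm : ∀ j, aorWeight γ i j * A k j * x j ≤ 0 := fun j => by
    rcases le_or_gt j i with h | h
    · exact mul_nonpos_of_nonpos_of_nonneg (mul_nonpos_of_nonneg_of_nonpos
        (aorWeight_nonneg hγ₀ i j) (hA k j (h.trans_lt hik).ne')) (hx j).le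
    · simp [aorWeight_of_gt h]
  have hsum : ∑ j, aorWeight γ i j * A k j * x j ≤ 0 := Finset.sum_nonpos fun j _ => hterm j
  refine ⟨by linarith, fun h => ⟨by linarith, fun j => ?_⟩⟩
  have h0 : ∑ j, aorWeight γ i j * A k j * x j = 0 := by linarith
  have := (Finset.sum_eq_zero_iff_of_nonpos fun j _ => hterm j).1 h0 j (Finset.mem_univ j)
  exact (mul_eq_zero.1 this).resolve_right (hx j).ne'

/-- The weight difference is 0 for j < k, equals 1 - γ at j = k, and is nonpositive for j > k, where
A k j ≤ 0 as well; every term is nonnegative. -/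
theorem residualTerm_of_gt (hA : IsZMatrix A) (hdiag : ∀ i, A i i = 1) (hγ₀ : 0 ≤ γ) (hγ₁ : γ ≤ 1)
    {x : Fin n → ℝ} (hx : ∀ i, 0 < x i) {i k : Fin n} (hik : k < i) :
    0 ≤ (aorM γ A *ᵥ x) k - ∑ j, aorWeight γ i j * A k j * x j ∧
      ((aorM γ A *ᵥ x) k - ∑ j, aorWeight γ i j * A k j * x j = 0 →
        ∀ j, (aorWeight γ k j - aorWeight γ i j) * A k j = 0) := by
  have heq : (aorM γ A *ᵥ x) k - ∑ j, aorWeight γ i j * A k j * x j =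
      ∑ j, (aorWeight γ k j - aorWeight γ i j) * A k j * x j := by
    simp only [Matrix.mulVec, dotProduct, aorM_apply, ← Finset.sum_sub_distrib]
    exact Finset.sum_congr rfl fun j _ => by ring
  have hterm : ∀ j, 0 ≤ (aorWeight γ k j - aorWeight γ i j) * A k j * x j := fun j => by
    refine mul_nonneg ?_ (hx j).le
    rcases lt_trichotomy j k with h | rfl | h
    · simp [aorWeight_of_lt h, aorWeight_of_lt (h.trans hik)]
    · rw [aorWeight_self, aorWeight_of_lt hik, hdiag]; linarith
    · rw [aorWeight_of_gt h]
      refine mul_nonneg_of_nonpos_of_nonpos ?_ (hA k j h.ne)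
      linarith [aorWeight_nonneg hγ₀ i j]
  rw [heq]
  refine ⟨Finset.sum_nonneg fun j _ => hterm j, fun h j => ?_⟩
  have := (Finset.sum_eq_zero_iff_of_nonneg fun j _ => hterm j).1 h j (Finset.mem_univ j)
  exact (mul_eq_zero.1 this).resolve_right (hx j).ne'

theorem residualTerm_nonneg (hA : IsZMatrix A) (hdiag : ∀ i, A i i = 1) (hα : IsAdmissible A α)
    (hγ₀ : 0 ≤ γ) (hγ₁ : γ ≤ 1) {x : Fin n → ℝ} (hx : ∀ i, 0 < x i)
    (hMx : ∀ k, 0 ≤ (aorM γ A *ᵥ x) k) (i k : Fin n) :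
    0 ≤ Q₂ A α i k * ((aorM γ A *ᵥ x) k - ∑ j, aorWeight γ i j * A k j * x j) := by
  rcases lt_trichotomy i k with h | rfl | h
  · exact mul_nonneg (Q₂_nonneg hA hα i k) (residualTerm_of_lt hA hγ₀ hx h (hMx k)).1
  · rw [Q₂_self hα, zero_mul]
  · exact mul_nonneg (Q₂_nonneg hA hα i k) (residualTerm_of_gt hA hdiag hγ₀ hγ₁ hx h).1

theorem aorResidual_mulVec_nonneg (hA : IsZMatrix A) (hdiag : ∀ i, A i i = 1)
    (hα : IsAdmissible A α) (hγ₀ : 0 ≤ γ) (hγ₁ : γ ≤ 1) {x : Fin n → ℝ} (hx : ∀ i, 0 < x i)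
    (hMx : ∀ k, 0 ≤ (aorM γ A *ᵥ x) k) (i : Fin n) : 0 ≤ (aorResidual γ A α *ᵥ x) i := by
  rw [aorResidual_mulVec]
  exact Finset.sum_nonneg fun k _ => residualTerm_nonneg hA hdiag hα hγ₀ hγ₁ hx hMx i k

/-- The sparsity pattern forced by a vanishing residual in row `i`. -/
theorem pattern_of_aorResidual_mulVec_eq_zero (hA : IsZMatrix A) (hdiag : ∀ i, A i i = 1)
    (hirr : IsIrreducibleMatrix A) (hn : 2 ≤ n)
    (hα : IsAdmissible A α) (hγ₀ : 0 ≤ γ) (hγ₁ : γ ≤ 1) {x : Fin n → ℝ} (hx : ∀ i, 0 < x i)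
    (hMx : ∀ k, 0 ≤ (aorM γ A *ᵥ x) k)
    (hMN : ∀ k, (aorM γ A *ᵥ x) k = 0 → ∀ j, aorN γ A k j = 0) {i : Fin n}
    (hi : (aorResidual γ A α *ᵥ x) i = 0) {k : Fin n} (hk : Q₂ A α i k ≠ 0) :
    γ = 1 ∧ (∀ j, k < j → j ≤ i → A k j = 0) ∧
      (i < k → ∀ j, k < j ∨ j ≤ i → A k j = 0) := by
  rw [aorResidual_mulVec] at hi
  have ht := (Finset.sum_eq_zero_iff_of_nonneg fun k _ =>
    residualTerm_nonneg hA hdiag hα hγ₀ hγ₁ hx hMx i k).1 hi k (Finset.mem_univ k)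
  have ht := (mul_eq_zero.1 ht).resolve_left hk
  rcases lt_trichotomy i k with h | rfl | h
  · obtain ⟨h1, h2⟩ := (residualTerm_of_lt hA hγ₀ hx h (hMx k)).2 ht
    have hN : ∀ j, (aorWeight γ k j - 1) * A k j = 0 := fun j => by
      rw [← aorN_apply]; exact hMN k h1 j
    -- Row k of N vanishes, yet row k of A has a nonzero off-diagonal entry; it must lie below the
    -- diagonal, with factor γ - 1 = 0.
    have hγ : γ = 1 := by
      by_contra hγ
      obtain ⟨j, hjk, hj⟩ := exists_ne_apply_ne_zero_of_isIrreducibleMatrix hirr hn k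
      have h3 := (mul_eq_zero.1 (hN j)).resolve_right hj
      rcases hjk.lt_or_gt with h | h
      · rw [aorWeight_of_lt h] at h3; exact hγ (by linarith)
      · rw [aorWeight_of_gt h] at h3; norm_num at h3
    subst hγ
    refine ⟨rfl, fun j hkj hji => absurd (hkj.trans_le hji) h.not_gt, fun _ j hj => ?_⟩
    rcases hj with hj | hj
    · simpa [aorWeight_of_gt hj] using hN j
    · rcases hj.lt_or_eq with hj | rfl
      · simpa [aorWeight_of_lt hj] using h2 j
      · simpa [aorWeight_self] using h2 j
  · exact absurd (Q₂_self hα i) hk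
  · have h2 := (residualTerm_of_gt hA hdiag hγ₀ hγ₁ hx h).2 ht
    -- The diagonal entry j = k contributes exactly 1 - γ.
    have hγ : γ = 1 := by
      have := h2 k
      rw [aorWeight_self, aorWeight_of_lt h, hdiag] at this
      linarith
    subst hγ
    refine ⟨rfl, fun j hkj hji => ?_, fun h' => absurd h' h.not_gt⟩
    have h3 := h2 j
    rw [aorWeight_of_gt hkj] at h3
    rcases hji.lt_or_eq with hj | rfl
    · simpa [aorWeight_of_lt hj] using h3
    · simpa [aorWeight_self] using h3

end Preconditioned

end PrecAOR

namespace PrecAOR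

open Matrix

/-! ### Perron vectors of the splittings and the comparison identity. -/

section Comparison

variable {n : ℕ} {A α : Matrix (Fin n) (Fin n) ℝ} {γ ω : ℝ}

theorem dotProduct_pos_of_nonneg_of_pos {y x : Fin n → ℝ} (hy : ∀ i, 0 ≤ y i) (hy0 : y ≠ 0)
    (hx : ∀ i, 0 < x i) : 0 < y ⬝ᵥ x := by
  obtain ⟨j, hj⟩ := Function.ne_iff.mp hy0
  exact Finset.sum_pos' (fun j _ => mul_nonneg (hy j) (hx j).le)
    ⟨j, Finset.mem_univ _, mul_pos (lt_of_le_of_ne (hy j) (Ne.symm hj)) (hx j)⟩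

/-- A nonsingular M-matrix is semipositive. -/
theorem IsNonsingularMMatrix.exists_mulVec_eq_one (hA : IsNonsingularMMatrix A) :
    ∃ x : Fin n → ℝ, (∀ i, 0 ≤ x i) ∧ A *ᵥ x = fun _ => 1 := by
  have hdet := (Matrix.isUnit_iff_isUnit_det A).1 hA.2.1
  refine ⟨A⁻¹ *ᵥ fun _ => 1, mulVec_nonneg_of_nonneg hA.2.2.1 fun _ => zero_le_one, ?_⟩
  rw [Matrix.mulVec_mulVec, Matrix.mul_nonsing_inv _ hdet, Matrix.one_mulVec]

theorem IsNonsingularMMatrix.nonpos_of_mulVec_nonpos (hA : IsNonsingularMMatrix A)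
    {x : Fin n → ℝ} (hx : ∀ i, (A *ᵥ x) i ≤ 0) (i : Fin n) : x i ≤ 0 := by
  have hdet := (Matrix.isUnit_iff_isUnit_det A).1 hA.2.1
  have h : x = A⁻¹ *ᵥ (A *ᵥ x) := by
    rw [Matrix.mulVec_mulVec, Matrix.nonsing_inv_mul _ hdet, Matrix.one_mulVec]
  rw [h, Matrix.mulVec, dotProduct]
  exact Finset.sum_nonpos fun j _ => mul_nonpos_of_nonneg_of_nonpos (hA.2.2.1 i j) (hx j)

theorem IsNonsingularMMatrix.nonpos_of_vecMul_nonpos (hA : IsNonsingularMMatrix A)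
    {x : Fin n → ℝ} (hx : ∀ i, (x ᵥ* A) i ≤ 0) (i : Fin n) : x i ≤ 0 := by
  have hdet := (Matrix.isUnit_iff_isUnit_det A).1 hA.2.1
  have h : x = (x ᵥ* A) ᵥ* A⁻¹ := by
    rw [Matrix.vecMul_vecMul, Matrix.mul_nonsing_inv _ hdet, Matrix.vecMul_one]
  rw [h, Matrix.vecMul, dotProduct]
  exact Finset.sum_nonpos fun j _ => mul_nonpos_of_nonpos_of_nonneg (hx j) (hA.2.2.1 j i)

/-- Every row of the iteration matrix of an irreducible Z-matrix has a positive entry. -/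
theorem aorM_inv_mul_aorN_mulVec_one_pos (hA : IsZMatrix A)
    (hirr : IsIrreducibleMatrix A) (hn : 2 ≤ n) (hγ₀ : 0 ≤ γ) (hγ₁ : γ ≤ 1)
    (hu : IsUnit (aorM γ A)) (hinv : ∀ i j, 0 ≤ (aorM γ A)⁻¹ i j) (i : Fin n) :
    0 < (((aorM γ A)⁻¹ * aorN γ A) *ᵥ fun _ => 1) i := by
  have hdet := (Matrix.isUnit_iff_isUnit_det _).1 hu
  set s := ((aorM γ A)⁻¹ * aorN γ A) *ᵥ (fun _ => (1 : ℝ)) with hs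
  have hs0 : ∀ i, 0 ≤ s i := mulVec_nonneg_of_nonneg
    (mul_entries_nonneg hinv (aorN_nonneg hγ₁ hA)) fun _ => zero_le_one
  have hMs : aorM γ A *ᵥ s = aorN γ A *ᵥ fun _ => 1 := by
    rw [hs, Matrix.mulVec_mulVec, ← Matrix.mul_assoc, Matrix.mul_nonsing_inv _ hdet,
      Matrix.one_mul]
  -- If s i = 0, all terms of row i of N1 - Ms vanish. A nonzero entry right of the diagonal
  -- contradicts this at once; one at j < i has factor (1-γ) + γ s j, positive by induction.
  induction i using WellFoundedLT.induction with
  | _ i ih =>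
    by_contra! hle
    have hsi : s i = 0 := le_antisymm hle (hs0 i)
    have h := congrFun hMs i
    have h0 : ∑ j, (aorN γ A i j - aorM γ A i j * s j) = 0 := by
      rw [Finset.sum_sub_distrib]
      simp only [Matrix.mulVec, dotProduct, mul_one] at h
      linarith
    have hterm : ∀ j, 0 ≤ aorN γ A i j - aorM γ A i j * s j := fun j => by
      have h1 := aorN_nonneg hγ₁ hA i j
      rcases eq_or_ne i j with rfl | hij
      · rw [hsi]; linarith
      · have := mul_nonpos_of_nonpos_of_nonneg (isZMatrix_aorM hγ₀ hA i j hij) (hs0 j)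
        linarith
    obtain ⟨j, hji, hj⟩ := exists_ne_apply_ne_zero_of_isIrreducibleMatrix hirr hn i
    have hz := (Finset.sum_eq_zero_iff_of_nonneg fun j _ => hterm j).1 h0 j (Finset.mem_univ j)
    rw [aorN_apply, aorM_apply] at hz
    rcases hji.lt_or_gt with hlt | hgt
    · have hsj := ih j hlt
      rw [aorWeight_of_lt hlt] at hz
      have hz' : ((1 - γ) + γ * s j) * A i j = 0 := by linarith
      have hz2 := (mul_eq_zero.1 hz').resolve_right hj
      rcases hγ₁.lt_or_eq with hγ | rfl
      · linarith [mul_nonneg hγ₀ hsj.le]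
      · linarith
    · rw [aorWeight_of_gt hgt] at hz
      exact hj (by linarith)

/-- A nonzero nonnegative generalized eigenvector of the AOR splitting of an irreducible matrix is
positive. -/
theorem pos_of_aorN_mulVec_eq (hA : IsZMatrix A)
    (hirr : IsIrreducibleMatrix A) (hγ₀ : 0 ≤ γ) (hγ₁ : γ ≤ 1) {r : ℝ} (hr : 0 < r)
    {x : Fin n → ℝ} (hx : ∀ i, 0 ≤ x i) (hx0 : x ≠ 0)
    (h : aorN γ A *ᵥ x = r • (aorM γ A *ᵥ x)) (i : Fin n) : 0 < x i := by
  by_contra! hi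
  refine hx0 (funext fun k => ?_)
  refine eq_univ_of_isIrreducibleMatrix hirr (S := {i | x i = 0}) ⟨i, le_antisymm hi (hx i)⟩
    (fun i hi j hj => ?_) k
  have hi : x i = 0 := hi
  have hj : x j ≠ 0 := hj
  have hij : i ≠ j := fun e => hj (e ▸ hi)
  have h0 : ∑ j, (aorN γ A i j - r * aorM γ A i j) * x j = 0 := by
    have := congrFun h i
    simp only [Matrix.mulVec, dotProduct, Pi.smul_apply, smul_eq_mul, Finset.mul_sum] at this
    rw [← sub_eq_zero, ← Finset.sum_sub_distrib] at this
    rw [← this]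
    exact Finset.sum_congr rfl fun j _ => by ring
  have hterm : ∀ j, 0 ≤ (aorN γ A i j - r * aorM γ A i j) * x j := fun j => by
    rcases eq_or_ne i j with rfl | hij
    · rw [hi, mul_zero]
    · have := mul_nonpos_of_nonneg_of_nonpos hr.le (isZMatrix_aorM hγ₀ hA i j hij)
      exact mul_nonneg (by linarith [aorN_nonneg hγ₁ hA i j]) (hx j)
  have hz := (Finset.sum_eq_zero_iff_of_nonneg fun j _ => hterm j).1 h0 j (Finset.mem_univ j)
  have hz := (mul_eq_zero.1 hz).resolve_right hj
  rw [aorN_apply, aorM_apply] at hz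
  have hz' : ((1 - aorWeight γ i j) + r * aorWeight γ i j) * A i j = 0 := by linarith
  refine (mul_eq_zero.1 hz').resolve_left ?_
  have h1 := aorWeight_nonneg hγ₀ i j
  have h2 := aorWeight_le_one hγ₁ i j
  rcases h2.lt_or_eq with h2 | h2
  · have := mul_nonneg hr.le h1
    linarith
  · rw [h2]; linarith

/-- The support of a nonnegative left generalized eigenvector of the AOR splitting of `B` has no
outgoing edges, and each of its elements has an incoming edge from it. -/
theorem support_of_vecMul_aorN_eq {B : Matrix (Fin n) (Fin n) ℝ} (hB : IsZMatrix B)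
    (hBd : ∀ i, 0 < B i i) (hγ₀ : 0 ≤ γ) (hγ₁ : γ ≤ 1) {r : ℝ} (hr : 0 < r)
    {z : Fin n → ℝ} (hz : ∀ i, 0 ≤ z i) (h : z ᵥ* aorN γ B = r • (z ᵥ* aorM γ B)) :
    (∀ i, 0 < z i → ∀ j, ¬ 0 < z j → B i j = 0) ∧
      ∀ j, 0 < z j → ∃ i, 0 < z i ∧ i ≠ j ∧ B i j ≠ 0 := by
  have hsum : ∀ j, ∑ i, z i * (((aorWeight γ i j - 1) - r * aorWeight γ i j) * B i j) = 0 := by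
    intro j
    have := congrFun h j
    simp only [Matrix.vecMul, dotProduct, Pi.smul_apply, smul_eq_mul, Finset.mul_sum,
      aorN_apply, aorM_apply] at this
    rw [← sub_eq_zero, ← Finset.sum_sub_distrib] at this
    rw [← this]
    exact Finset.sum_congr rfl fun j _ => by ring
  -- N - rM is B with every entry multiplied by a negative factor, so it has the zero pattern of B
  -- and reversed signs.
  have hc : ∀ i j : Fin n, (aorWeight γ i j - 1) - r * aorWeight γ i j < 0 := fun i j => by
    have h1 := aorWeight_nonneg hγ₀ i j
    have h2 := aorWeight_le_one hγ₁ i j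
    rcases h2.lt_or_eq with h2 | h2
    · have := mul_nonneg hr.le h1
      linarith
    · rw [h2]; linarith
  refine ⟨fun i hi j hj => ?_, fun j hj => ?_⟩
  · have hzj : z j = 0 := le_antisymm (not_lt.1 hj) (hz j)
    have hterm : ∀ i, 0 ≤ z i * (((aorWeight γ i j - 1) - r * aorWeight γ i j) * B i j) := by
      intro i
      rcases eq_or_ne i j with rfl | hij
      · rw [hzj, zero_mul]
      · exact mul_nonneg (hz i) (mul_nonneg_of_nonpos_of_nonpos (hc i j).le (hB i j hij))
    have h0 := (Finset.sum_eq_zero_iff_of_nonneg fun i _ => hterm i).1 (hsum j) i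
      (Finset.mem_univ i)
    exact (mul_eq_zero.1 ((mul_eq_zero.1 h0).resolve_left hi.ne')).resolve_left (hc i j).ne
  · by_contra! hno
    have h0 := hsum j
    rw [Finset.sum_eq_single j] at h0
    · exact (mul_neg_of_pos_of_neg hj (mul_neg_of_neg_of_pos (hc j j) (hBd j))).ne h0
    · intro i _ hij
      rcases (hz i).lt_or_eq with hi | hi
      · rw [hno i hi hij]; ring
      · rw [← hi, zero_mul]
    · exact fun h => absurd (Finset.mem_univ j) h

theorem mulVec_eq_of_smul_one_add {T : Matrix (Fin n) (Fin n) ℝ} {x : Fin n → ℝ} {r : ℝ}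
    (hω : 0 < ω) (h : ((1 - ω) • (1 : Matrix (Fin n) (Fin n) ℝ) + ω • T) *ᵥ x = r • x) :
    T *ᵥ x = ((r - (1 - ω)) / ω) • x := by
  rw [Matrix.add_mulVec, Matrix.smul_mulVec, Matrix.smul_mulVec, Matrix.one_mulVec] at h
  funext i
  have := congrFun h i
  simp only [Pi.add_apply, Pi.smul_apply, smul_eq_mul] at this ⊢
  field_simp
  linarith

theorem vecMul_eq_of_smul_one_add {T : Matrix (Fin n) (Fin n) ℝ} {x : Fin n → ℝ} {r : ℝ}
    (hω : 0 < ω) (h : x ᵥ* ((1 - ω) • (1 : Matrix (Fin n) (Fin n) ℝ) + ω • T) = r • x) :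
    x ᵥ* T = ((r - (1 - ω)) / ω) • x := by
  rw [← Matrix.mulVec_transpose] at h ⊢
  refine mulVec_eq_of_smul_one_add hω ?_
  simpa using h

/-- Perron data of the AOR iteration matrix of an irreducible nonsingular M-matrix. -/
theorem exists_pos_perron_aorMatrix (hA : IsNonsingularMMatrix A)
    (hirr : IsIrreducibleMatrix A) (hn : 2 ≤ n) (hω₀ : 0 < ω) (hω₁ : ω ≤ 1)
    (hγ₀ : 0 ≤ γ) (hγ₁ : γ ≤ 1) :
    ∃ r : ℝ, 0 < r ∧ r < 1 ∧ rho (aorMatrix γ ω A) = ENNReal.ofReal ((1 - ω) + ω * r) ∧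
      ∃ x : Fin n → ℝ, (∀ i, 0 < x i) ∧ aorN γ A *ᵥ x = r • (aorM γ A *ᵥ x) := by
  have : NeZero n := ⟨by omega⟩
  obtain ⟨p, hp, hAp⟩ := hA.exists_mulVec_eq_one
  have hMp := aorM_mulVec_pos (γ := γ) hγ₁ hA.1 hp fun i => by rw [hAp]; exact one_pos
  have hMZ := isZMatrix_aorM hγ₀ hA.1
  have hu := hMZ.isUnit_of_mulVec_pos hp hMp
  have hinv := hMZ.inv_nonneg_of_mulVec_pos hp hMp
  have hdet := (Matrix.isUnit_iff_isUnit_det _).1 hu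
  obtain ⟨t, -, hρ, ⟨x, hx, hx0, hTx⟩, y, hy, hy0, hyT⟩ :=
    exists_right_left_perron (aorMatrix_nonneg hω₀ hω₁ hγ₁ hA.1 hu hinv)
  rw [aorMatrix_eq hu] at hTx hyT
  have hTx := mulVec_eq_of_smul_one_add hω₀ hTx
  have hyT := vecMul_eq_of_smul_one_add hω₀ hyT
  set r := (t - (1 - ω)) / ω with hr
  have hrpos : 0 < r := by
    have h1 := dotProduct_pos_of_nonneg_of_pos hy hy0
      (aorM_inv_mul_aorN_mulVec_one_pos hA.1 hirr hn hγ₀ hγ₁ hu hinv)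
    rw [Matrix.dotProduct_mulVec, hyT, smul_dotProduct, smul_eq_mul] at h1
    exact pos_of_mul_pos_left h1
      (dotProduct_pos_of_nonneg_of_pos hy hy0 fun _ => one_pos).le
  have hNx : aorN γ A *ᵥ x = r • (aorM γ A *ᵥ x) := by
    rw [← Matrix.mulVec_smul, ← hTx, Matrix.mulVec_mulVec, ← Matrix.mul_assoc,
      Matrix.mul_nonsing_inv _ hdet, Matrix.one_mul]
  have hxpos := pos_of_aorN_mulVec_eq hA.1 hirr hγ₀ hγ₁ hrpos hx hx0 hNx
  refine ⟨r, hrpos, ?_, ?_, x, hxpos, hNx⟩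
  -- If r ≥ 1, then Ax = (1-r)Mx ≤ 0, and A⁻¹ ≥ 0 would give x ≤ 0.
  · by_contra! h1
    refine (hxpos ⟨0, by omega⟩).not_ge (hA.nonpos_of_mulVec_nonpos (fun i => ?_) _)
    have h2 : (A *ᵥ x) i = (aorM γ A *ᵥ x) i - (aorN γ A *ᵥ x) i := by
      rw [← Pi.sub_apply, ← Matrix.sub_mulVec, aorM_sub_aorN]
    have h3 := mulVec_nonneg_of_nonneg (aorN_nonneg hγ₁ hA.1) hx i
    rw [hNx, Pi.smul_apply, smul_eq_mul] at h2 h3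
    have h4 : 0 ≤ (aorM γ A *ᵥ x) i := nonneg_of_mul_nonneg_right h3 hrpos
    nlinarith
  · rw [hρ, hr, mul_div_cancel₀ _ hω₀.ne']
    congr 1
    ring

/-- Either preconditioning strictly decreases the spectral radius, or the residual of the Perron
vector vanishes on a nonempty set of rows that has no outgoing edges in the preconditioned
matrix. -/
theorem rho_lt_or_exists_stationary (hA : IsNonsingularMMatrix A) (hdiag : ∀ i, A i i = 1)
    (hirr : IsIrreducibleMatrix A) (hn : 2 ≤ n) (hα : IsAdmissible A α) (hoff : OffNonpos A α)
    (hω₀ : 0 < ω) (hω₁ : ω ≤ 1) (hγ₀ : 0 ≤ γ) (hγ₁ : γ ≤ 1) :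
    IsUnit (aorM γ (A₂ A α)) ∧ rho (aorMatrix γ ω A) < 1 ∧
      (rho (aorMatrix γ ω (A₂ A α)) < rho (aorMatrix γ ω A) ∨
        ∃ (x : Fin n → ℝ) (S : Set (Fin n)), (∀ i, 0 < x i) ∧
          (∀ k, 0 ≤ (aorM γ A *ᵥ x) k) ∧
          (∀ k, (aorM γ A *ᵥ x) k = 0 → ∀ j, aorN γ A k j = 0) ∧
          S.Nonempty ∧ (∀ i ∈ S, ∀ j, j ∉ S → A₂ A α i j = 0) ∧
          (∀ j ∈ S, ∃ i ∈ S, i ≠ j ∧ A₂ A α i j ≠ 0) ∧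
          ∀ i ∈ S, (aorResidual γ A α *ᵥ x) i = 0) := by
  have : NeZero n := ⟨by omega⟩
  have hB := isZMatrix_A₂ hdiag hα hoff
  obtain ⟨p, hp, hAp⟩ := hA.exists_mulVec_eq_one
  have hBp : ∀ i, 0 < (A₂ A α *ᵥ p) i := fun i => by
    rw [A₂, ← Matrix.mulVec_mulVec, hAp, Matrix.add_mulVec, Matrix.one_mulVec, Pi.add_apply]
    exact add_pos_of_pos_of_nonneg one_pos
      (mulVec_nonneg_of_nonneg (Q₂_nonneg hA.1 hα) (fun _ => zero_le_one) i)
  have hMp := aorM_mulVec_pos (γ := γ) hγ₁ hB hp hBp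
  have hMZ := isZMatrix_aorM hγ₀ hB
  have hu := hMZ.isUnit_of_mulVec_pos hp hMp
  have hinv := hMZ.inv_nonneg_of_mulVec_pos hp hMp
  have hdet := (Matrix.isUnit_iff_isUnit_det _).1 hu
  obtain ⟨r, hr0, hr1, hρ, x, hx, hNx⟩ :=
    exists_pos_perron_aorMatrix hA hirr hn hω₀ hω₁ hγ₀ hγ₁
  obtain ⟨t, ht0, hρ₂, -, y, hy, hy0, hyT⟩ :=
    exists_right_left_perron (aorMatrix_nonneg hω₀ hω₁ hγ₁ hB hu hinv)
  rw [aorMatrix_eq hu] at hyT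
  have hyT := vecMul_eq_of_smul_one_add hω₀ hyT
  set r₂ := (t - (1 - ω)) / ω with hr₂
  have ht : t = (1 - ω) + ω * r₂ := by rw [hr₂, mul_div_cancel₀ _ hω₀.ne']; ring
  refine ⟨hu, ?_, ?_⟩
  · rw [hρ, ENNReal.ofReal_lt_one]
    nlinarith
  have hMx : ∀ k, (aorN γ A *ᵥ x) k = r * (aorM γ A *ᵥ x) k := fun k => by
    rw [hNx, Pi.smul_apply, smul_eq_mul]
  have hNx0 := mulVec_nonneg_of_nonneg (aorN_nonneg hγ₁ hA.1) fun i => (hx i).le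
  have hMx0 : ∀ k, 0 ≤ (aorM γ A *ᵥ x) k := fun k =>
    nonneg_of_mul_nonneg_right (hMx k ▸ hNx0 k) hr0
  have hEx := aorResidual_mulVec_nonneg hA.1 hdiag hα hγ₀ hγ₁ hx hMx0
  rcases lt_or_ge r₂ r with hlt | hge
  · left
    rw [hρ, hρ₂, ht]
    have := mul_lt_mul_of_pos_left hlt hω₀
    refine (ENNReal.ofReal_lt_ofReal_iff ?_).2 (by linarith)
    nlinarith
  right
  set z := y ᵥ* (aorM γ (A₂ A α))⁻¹ with hz
  have hz0 : ∀ i, 0 ≤ z i := fun i => by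
    rw [hz, Matrix.vecMul, dotProduct]
    exact Finset.sum_nonneg fun j _ => mul_nonneg (hy j) (hinv j i)
  have hzM : z ᵥ* aorM γ (A₂ A α) = y := by
    rw [hz, Matrix.vecMul_vecMul, Matrix.nonsing_inv_mul _ hdet, Matrix.vecMul_one]
  have hzN : z ᵥ* aorN γ (A₂ A α) = r₂ • (z ᵥ* aorM γ (A₂ A α)) := by
    rw [hzM, ← hyT, hz, Matrix.vecMul_vecMul]
  have hzne : z ≠ 0 := fun h => hy0 (by rw [← hzM, h, Matrix.zero_vecMul])
  obtain ⟨hout, hin⟩ := support_of_vecMul_aorN_eq hB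
    (fun i => (hB.pos_of_mulVec_pos hp hBp i).1) hγ₀ hγ₁ (hr0.trans_le hge) hz0 hzN
  have hAx : A *ᵥ x = (1 - r) • (aorM γ A *ᵥ x) := by
    conv_lhs => rw [← aorM_sub_aorN (γ := γ) (B := A)]
    rw [Matrix.sub_mulVec, hNx]; module
  -- Both sides come from z A⁽²⁾ x: on the left of x it is (1 - r₂) y·x, and through Ax = (1-r)Mx it
  -- is (1-r)(z·Ex + y·x).
  have hkey : (r - r₂) * (y ⬝ᵥ x) = (1 - r) * (z ⬝ᵥ (aorResidual γ A α *ᵥ x)) := by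
    have h1 : aorM γ (A₂ A α) *ᵥ x - aorN γ (A₂ A α) *ᵥ x =
        (1 - r) • (aorResidual γ A α *ᵥ x + aorM γ (A₂ A α) *ᵥ x) := by
      rw [← Matrix.sub_mulVec, aorM_sub_aorN, A₂, ← Matrix.mulVec_mulVec, hAx,
        Matrix.mulVec_smul, Matrix.mulVec_mulVec, ← Matrix.add_mulVec, ← A₂, aorResidual,
        sub_add_cancel]
    have h2 := congrArg (fun v => z ⬝ᵥ v) h1
    simp only [dotProduct_sub, dotProduct_smul, dotProduct_add, Matrix.dotProduct_mulVec z,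
      smul_eq_mul] at h2
    rw [hzN, hzM, smul_dotProduct, smul_eq_mul] at h2
    rw [Matrix.dotProduct_mulVec]
    linarith
  have hyx := dotProduct_pos_of_nonneg_of_pos hy hy0 hx
  have hterm : ∀ i, 0 ≤ z i * (aorResidual γ A α *ᵥ x) i := fun i => mul_nonneg (hz0 i) (hEx i)
  have hzE : z ⬝ᵥ (aorResidual γ A α *ᵥ x) = 0 := by
    refine le_antisymm ?_ (Finset.sum_nonneg fun i _ => hterm i)
    have h3 : (1 - r) * (z ⬝ᵥ (aorResidual γ A α *ᵥ x)) ≤ 0 := by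
      rw [← hkey]; exact mul_nonpos_of_nonpos_of_nonneg (by linarith) hyx.le
    exact nonpos_of_mul_nonpos_right h3 (by linarith)
  refine ⟨x, {i | 0 < z i}, hx, hMx0, fun k hk j => ?_, ?_, hout, hin, fun i hi => ?_⟩
  · have h4 : (aorN γ A *ᵥ x) k = 0 := by rw [hMx, hk, mul_zero]
    rw [Matrix.mulVec, dotProduct] at h4
    have h5 := (Finset.sum_eq_zero_iff_of_nonneg fun j _ =>
      mul_nonneg (aorN_nonneg hγ₁ hA.1 k j) (hx j).le).1 h4 j (Finset.mem_univ j)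
    exact (mul_eq_zero.1 h5).resolve_right (hx j).ne'
  · obtain ⟨j, hj⟩ := Function.ne_iff.mp hzne
    exact ⟨j, lt_of_le_of_ne (hz0 j) (Ne.symm hj)⟩
  · have h5 := (Finset.sum_eq_zero_iff_of_nonneg fun i _ => hterm i).1 hzE i (Finset.mem_univ i)
    exact (mul_eq_zero.1 h5).resolve_left (ne_of_gt hi)

end Comparison

end PrecAOR

namespace PrecAOR

open Matrix

/-! ### Zero patterns for γ = 1. -/

section RowPattern

variable {n : ℕ} {A α : Matrix (Fin n) (Fin n) ℝ}

/-- The sparsity pattern forced by a vanishing residual in row `i` for `γ = 1`. -/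
def RowPattern {n : ℕ} (A α : Matrix (Fin n) (Fin n) ℝ) (i : Fin n) : Prop :=
  ∀ k, Q₂ A α i k ≠ 0 →
    (∀ j, k < j → j ≤ i → A k j = 0) ∧ (i < k → ∀ j, k < j ∨ j ≤ i → A k j = 0)

theorem Q₂_ne_zero_of_mul_pos {i k j : Fin n} (h : 0 < α i k * A i k * A k j) :
    Q₂ A α i k ≠ 0 ∧ A k j ≠ 0 :=
  ⟨neg_ne_zero.2 (left_ne_zero_of_mul h.ne'), right_ne_zero_of_mul h.ne'⟩

theorem Q₂_ne_zero_of_neg_of_pos {i k : Fin n} (hA : A i k < 0) (hα : 0 < α i k) :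
    Q₂ A α i k ≠ 0 :=
  neg_ne_zero.2 (mul_ne_zero hα.ne' hA.ne)

theorem RowPattern.not_pos_of_gt {i k j : Fin n} (hi : RowPattern A α i) (hik : i < k)
    (hj : k < j ∨ j ≤ i) : ¬ 0 < α i k * A i k * A k j := fun h =>
  (Q₂_ne_zero_of_mul_pos h).2 ((hi k (Q₂_ne_zero_of_mul_pos h).1).2 hik j hj)

theorem RowPattern.not_pos_of_le {i k j : Fin n} (hi : RowPattern A α i) (hkj : k < j)
    (hj : j ≤ i) : ¬ 0 < α i k * A i k * A k j := fun h =>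
  (Q₂_ne_zero_of_mul_pos h).2 ((hi k (Q₂_ne_zero_of_mul_pos h).1).1 j hkj hj)

theorem RowPattern.not_diag_pos (hα : IsAdmissible A α) {i k : Fin n} (hi : RowPattern A α i) :
    ¬ 0 < α i k * A i k * A k i := by
  rcases lt_trichotomy i k with h | rfl | h
  · exact hi.not_pos_of_gt h (Or.inr le_rfl)
  · simp [hα.1]
  · exact hi.not_pos_of_le h le_rfl

theorem exists_pos_of_sum_filter_pos {p : Fin n → Prop} [DecidablePred p] {f : Fin n → ℝ}
    (h : 0 < ∑ k with p k, f k) : ∃ k, p k ∧ 0 < f k := by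
  by_contra! hno
  exact h.not_ge (Finset.sum_nonpos fun k hk => hno k (Finset.mem_filter.1 hk).2)

/-- At γ = 1 only the sums remain, and their index ranges lie in the positions where the pattern
makes A k j vanish. -/
theorem RowPattern.not_delta_pos (hα : IsAdmissible A α) {i j : Fin n} (hi : RowPattern A α i) :
    ¬ 0 < delta₂ A α 1 i j := by
  intro h
  unfold delta₂ at h
  simp only [sub_self, zero_mul, one_mul, zero_add] at h
  split_ifs at h with h1 h2
  · obtain ⟨k, -, hk⟩ := exists_pos_of_sum_filter_pos h
    exact hi.not_diag_pos hα hk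
  · obtain ⟨k, hk, hp⟩ := exists_pos_of_sum_filter_pos h
    exact hi.not_pos_of_gt hk.1 (Or.inl hk.2) hp
  · obtain ⟨k, hk, hp⟩ := exists_pos_of_sum_filter_pos h
    have hji : j ≤ i := not_lt.1 h2
    rcases hk with hk | hk
    · exact hi.not_pos_of_le hk hji hp
    · exact hi.not_pos_of_gt hk (Or.inr hji) hp

end RowPattern

/-! ### Each alternative hypothesis excludes the stationary set S. -/

section Conditions

variable {m : ℕ} {A α : Matrix (Fin (m + 1)) (Fin (m + 1)) ℝ}

/-- No index lies strictly between i and i + 1, so the pattern would annihilate the whole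
off-diagonal part of row i + 1, against irreducibility. -/
theorem RowPattern.not_succ (hirr : IsIrreducibleMatrix A) (hn : 2 ≤ m + 1) {k : Fin m}
    (hi : RowPattern A α k.castSucc) :
    ¬ (A k.castSucc k.succ < 0 ∧ 0 < α k.castSucc k.succ) := by
  rintro ⟨h1, h2⟩
  obtain ⟨j, hj, hA⟩ := exists_ne_apply_ne_zero_of_isIrreducibleMatrix hirr hn k.succ
  refine hA ((hi _ (Q₂_ne_zero_of_neg_of_pos h1 h2)).2 Fin.castSucc_lt_succ j ?_)
  rcases hj.lt_or_gt with h | h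
  · exact Or.inr (Fin.le_castSucc_iff.2 h)
  · exact Or.inl h

theorem RowPattern.not_last_zero (hirr : IsIrreducibleMatrix A) (hn : 2 ≤ m + 1)
    (hi : RowPattern A α (Fin.last m)) :
    ¬ (A (Fin.last m) 0 < 0 ∧ 0 < α (Fin.last m) 0) := by
  rintro ⟨h1, h2⟩
  obtain ⟨j, hj, hA⟩ := exists_ne_apply_ne_zero_of_isIrreducibleMatrix hirr hn 0
  exact hA ((hi _ (Q₂_ne_zero_of_neg_of_pos h1 h2)).1 j (Fin.pos_iff_ne_zero.2 hj) (Fin.le_last j))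

theorem RowPattern.not_last_pos (hα : IsAdmissible A α) {i j : Fin (m + 1)}
    (hi : RowPattern A α i) (hj : j ≤ i) :
    ¬ 0 < α i (Fin.last m) * A i (Fin.last m) * A (Fin.last m) j := by
  rcases (Fin.le_last i).lt_or_eq with h | rfl
  · exact hi.not_pos_of_gt h (Or.inr hj)
  · simp [hα.1]

theorem RowPattern.not_castSucc_pos (hα : IsAdmissible A α) {i : Fin (m + 1)} {j : Fin m}
    (hi : RowPattern A α i) :
    ¬ 0 < α i j.castSucc * A i j.castSucc * A j.castSucc j.succ := by
  rcases lt_trichotomy i j.castSucc with h | rfl | h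
  · exact hi.not_pos_of_gt h (Or.inl Fin.castSucc_lt_succ)
  · simp [hα.1]
  · exact hi.not_pos_of_le Fin.castSucc_lt_succ (Fin.castSucc_lt_iff_succ_le.1 h)

theorem RowPattern.not_rowCondSix (hirr : IsIrreducibleMatrix A) (hn : 2 ≤ m + 1)
    (hα : IsAdmissible A α) {i : Fin (m + 1)} (hi : RowPattern A α i) : ¬ RowCondSix A α i := by
  rintro (⟨j, h⟩ | ⟨k, rfl, h⟩ | ⟨j, h⟩ | ⟨j, hj, h⟩ | ⟨j, hj, h⟩ | ⟨j, h⟩)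
  · exact hi.not_delta_pos hα h
  · exact hi.not_succ hirr hn h
  · exact hi.not_diag_pos hα h
  · exact hi.not_last_pos hα hj h
  · exact hi.not_pos_of_gt hj (Or.inr (Fin.zero_le i)) h
  · exact hi.not_castSucc_pos hα h

theorem RowPattern.not_rowCondSeven (hirr : IsIrreducibleMatrix A) (hn : 2 ≤ m + 1)
    (hα : IsAdmissible A α) {i : Fin (m + 1)} (hi : RowPattern A α i) :
    ¬ RowCondSeven A α i := by
  rintro (h | ⟨j, hj0, hj, h⟩)
  · exact hi.not_rowCondSix hirr hn hα h
  · exact hi.not_pos_of_le hj0 hj h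

theorem not_globalCond_of_rowPattern (hirr : IsIrreducibleMatrix A) (hn : 2 ≤ m + 1)
    (hα : IsAdmissible A α) (hp : ∀ i, RowPattern A α i) : ¬ GlobalCond A α := by
  rintro (⟨i, j, h⟩ | h | ⟨k, h⟩ | ⟨i, j, h⟩ | ⟨i, j, -, hj, h⟩ | ⟨i, j, hij, h⟩ | ⟨i, j, h⟩ |
    ⟨i, j, hj0, hj, h⟩ | ⟨h0, h⟩)
  · exact (hp i).not_delta_pos hα h
  · exact (hp _).not_last_zero hirr hn h
  · exact (hp _).not_succ hirr hn h
  · exact (hp i).not_diag_pos hα h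
  · exact (hp i).not_last_pos hα hj h
  · exact (hp i).not_pos_of_gt hij (Or.inr (Fin.zero_le i)) h
  · exact (hp i).not_castSucc_pos hα h
  · exact (hp i).not_pos_of_le hj0 hj h
  -- Any nonzero Q₂ i k kills the corner entry of the last row if k is last, and the superdiagonal
  -- entry of row k otherwise.
  · obtain ⟨i, k, hik, hQ⟩ := exists_Q₂_ne_zero hα
    induction k using Fin.lastCases with
    | last =>
      exact h0.ne ((hp i _ hQ).2 (lt_of_le_of_ne (Fin.le_last i) hik) 0 (Or.inr (Fin.zero_le i)))
    | cast k =>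
      rcases hik.lt_or_gt with hlt | hgt
      · exact (h k).ne ((hp i _ hQ).2 hlt _ (Or.inl Fin.castSucc_lt_succ))
      · exact (h k).ne ((hp i _ hQ).1 _ Fin.castSucc_lt_succ (Fin.castSucc_lt_iff_succ_le.1 hgt))

theorem OffLesssim.offNonpos {n : ℕ} {A α : Matrix (Fin n) (Fin n) ℝ} (hA : IsZMatrix A)
    (hα : IsAdmissible A α) (h : OffLesssim A α) :
    OffNonpos A α := fun i j hij => by
  rcases (hA i j hij).lt_or_eq with hlt | heq
  · rcases h with h | h
    · exact (h i j hij hlt).le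
    · exact h.1 i j hij hlt
  · rw [offEntry, heq, mul_zero, zero_sub, neg_nonpos]
    refine Finset.sum_nonneg fun k hk => ?_
    obtain ⟨hki, hkj⟩ := (Finset.mem_filter.1 hk).2
    exact mul_nonneg_of_nonpos_of_nonpos
      (mul_nonpos_of_nonneg_of_nonpos (hα.2.1 i k hki.symm) (hA i k hki.symm)) (hA k j hkj)

/-- With strict inequalities every edge of A is an edge of A⁽²⁾, so a set closed for A⁽²⁾ is closed
for A; otherwise A⁽²⁾ is itself irreducible. -/
theorem OffLesssim.eq_univ {n : ℕ} {A α : Matrix (Fin n) (Fin n) ℝ} (hA : IsZMatrix A)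
    (hdiag : ∀ i, A i i = 1) (hirr : IsIrreducibleMatrix A)
    (hα : IsAdmissible A α) (h : OffLesssim A α) {S : Set (Fin n)} (hS : S.Nonempty)
    (hcl : ∀ i ∈ S, ∀ j, j ∉ S → A₂ A α i j = 0) (i : Fin n) : i ∈ S := by
  rcases h with h | h
  · refine eq_univ_of_isIrreducibleMatrix hirr hS (fun i hi j hj => ?_) i
    have hij : i ≠ j := fun e => hj (e ▸ hi)
    by_contra hne
    have := h i j hij (lt_of_le_of_ne (hA i j hij) hne)
    rw [← A₂_eq_offEntry hdiag hα hij, hcl i hi j hj] at this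
    exact lt_irrefl _ this
  · exact eq_univ_of_isIrreducibleMatrix h.2 hS hcl i

/-- The row patterns are incompatible with the lower triangular comparison. -/
theorem not_lowerCond_of_stationary {n : ℕ} {A α : Matrix (Fin n) (Fin n) ℝ} {x : Fin n → ℝ}
    {S : Set (Fin n)}
    (hA : IsNonsingularMMatrix A) (hdiag : ∀ i, A i i = 1) (hirr : IsIrreducibleMatrix A)
    (hα : IsAdmissible A α) (hx : ∀ i, 0 < x i) (hMx : ∀ k, 0 ≤ (aorM 1 A *ᵥ x) k)
    (hMN : ∀ k, (aorM 1 A *ᵥ x) k = 0 → ∀ j, aorN 1 A k j = 0)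
    (hS : S.Nonempty) (hcl : ∀ i ∈ S, ∀ j, j ∉ S → A₂ A α i j = 0)
    (hE : ∀ i ∈ S, (aorResidual 1 A α *ᵥ x) i = 0) : ¬ LowerCond A α 1 := by
  rintro ⟨-, hlow, hwit⟩
  have hQ := Q₂_nonneg hA.1 hα
  have hdg : ∀ i, 0 ≤ diagGap A α i := fun i => Finset.sum_nonneg fun k hk => by
    have hk : k ≠ i := (Finset.mem_filter.1 hk).2
    exact mul_nonneg_of_nonpos_of_nonpos
      (mul_nonpos_of_nonneg_of_nonpos (hα.2.1 i k hk.symm) (hA.1 i k hk.symm)) (hA.1 k i hk)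
  have hMM : ∀ i j, (aorM 1 A - aorM 1 (A₂ A α)) i j =
      if i = j then diagGap A α i else if j < i then lowerGap A α i j else 0 := fun i j => by
    rw [Matrix.sub_apply, aorM_apply, aorM_apply, aorWeight]
    split_ifs with h1 h2
    · subst h1; rw [A₂_self hα]; ring
    · rw [A₂_eq_sub_lowerGap hdiag hα h1]; ring
    · ring
  have hMM0 : ∀ i j, 0 ≤ (aorM 1 A - aorM 1 (A₂ A α)) i j := fun i j => by
    rw [hMM]
    split_ifs with h1 h2
    exacts [hdg i, hlow i j h2, le_rfl]
  -- Here E = Q₂M + (M - M₂), and the lower comparison makes M - M₂ ≥ 0, so both parts vanish on S.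
  have hsplit : ∀ i ∈ S, (Q₂ A α *ᵥ (aorM 1 A *ᵥ x)) i = 0 ∧
      ((aorM 1 A - aorM 1 (A₂ A α)) *ᵥ x) i = 0 := fun i hi => by
    have h1 := hE i hi
    rw [aorResidual_mulVec_eq_add, Pi.add_apply] at h1
    have h2 := mulVec_nonneg_of_nonneg hQ hMx i
    have h3 := mulVec_nonneg_of_nonneg hMM0 (fun i => (hx i).le) i
    exact ⟨by linarith, by linarith⟩
  have hupper : ∀ i ∈ S, ∀ k, Q₂ A α i k ≠ 0 → ∀ j, k < j → A k j = 0 := by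
    intro i hi k hk j hkj
    have h1 := (hsplit i hi).1
    rw [Matrix.mulVec, dotProduct] at h1
    have h2 := (Finset.sum_eq_zero_iff_of_nonneg fun k _ => mul_nonneg (hQ i k) (hMx k)).1 h1 k
      (Finset.mem_univ k)
    have h3 := hMN k ((mul_eq_zero.1 h2).resolve_left hk) j
    rw [aorN_apply, aorWeight_of_gt hkj] at h3
    linarith
  have hrow : ∀ i ∈ S, ∀ j, (aorM 1 A - aorM 1 (A₂ A α)) i j = 0 := fun i hi j => by
    have h1 := (hsplit i hi).2
    rw [Matrix.mulVec, dotProduct] at h1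
    have h2 := (Finset.sum_eq_zero_iff_of_nonneg fun j _ =>
      mul_nonneg (hMM0 i j) (hx j).le).1 h1 j (Finset.mem_univ j)
    exact (mul_eq_zero.1 h2).resolve_right (hx j).ne'
  -- S together with its Q₂-successors is closed for A: for j outside, A⁽²⁾ s j = 0 is a sum of
  -- nonpositive terms, so A s j and all Q₂ s k * A k j vanish.
  have hcover : ∀ i, i ∈ S ∨ ∃ s ∈ S, Q₂ A α s i ≠ 0 := by
    have hexit : ∀ s ∈ S, ∀ j, ¬ (j ∈ S ∨ ∃ s ∈ S, Q₂ A α s j ≠ 0) →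
        A s j = 0 ∧ ∀ k, Q₂ A α s k * A k j = 0 := by
      intro s hs j hj
      push Not at hj
      have hsj : s ≠ j := fun e => hj.1 (e ▸ hs)
      have hterm : ∀ k, Q₂ A α s k * A k j ≤ 0 := fun k => by
        rcases eq_or_ne k j with rfl | hkj
        · rw [hj.2 s hs, zero_mul]
        · exact mul_nonpos_of_nonneg_of_nonpos (hQ s k) (hA.1 k j hkj)
      have h1 := hcl s hs j hj.1
      rw [A₂_apply] at h1
      have h2 : ∑ k, Q₂ A α s k * A k j ≤ 0 := Finset.sum_nonpos fun k _ => hterm k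
      have h3 := hA.1 s j hsj
      refine ⟨by linarith, fun k => ?_⟩
      have h4 : ∑ k, Q₂ A α s k * A k j = 0 := by linarith
      exact (Finset.sum_eq_zero_iff_of_nonpos fun k _ => hterm k).1 h4 k (Finset.mem_univ k)
    refine eq_univ_of_isIrreducibleMatrix hirr (S := {i | i ∈ S ∨ ∃ s ∈ S, Q₂ A α s i ≠ 0})
      (hS.mono fun i hi => Or.inl hi) ?_
    rintro i (hi | ⟨s, hs, hsi⟩) j hj
    · exact (hexit i hi j hj).1
    · exact (mul_eq_zero.1 ((hexit s hs j hj).2 i)).resolve_left hsi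
  have hzero : ∀ i j, (aorM 1 A - aorM 1 (A₂ A α)) i j = 0 := by
    intro i j
    rcases hcover i with hi | ⟨s, hs, hsi⟩
    · exact hrow i hi j
    -- For a Q₂-successor i, row i of A is zero right of the diagonal, so q = Q₂ i is supported on k
    -- < i. Then qA ≤ 0: left of column i by `lowerGap` ≥ 0, elsewhere by signs. Since A⁻¹ ≥ 0, q ≤
    -- 0.
    have hQ0 : ∀ k, Q₂ A α i k = 0 := by
      have hQgt : ∀ k, i ≤ k → Q₂ A α i k = 0 := fun k hk => by
        rcases hk.lt_or_eq with hk | rfl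
        · rw [Q₂_apply, hupper s hs i hsi k hk, mul_zero, neg_zero]
        · exact Q₂_self hα i
      refine fun k => le_antisymm (hA.nonpos_of_vecMul_nonpos (x := Q₂ A α i) (fun l => ?_) k)
        (hQ i k)
      rw [Matrix.vecMul, dotProduct]
      rcases lt_or_ge l i with hl | hl
      · have h1 := A₂_apply (A := A) (α := α) i l
        rw [A₂_eq_sub_lowerGap hdiag hα hl.ne'] at h1
        linarith [hlow i l hl]
      · refine Finset.sum_nonpos fun k _ => ?_
        rcases eq_or_ne k l with rfl | hkl
        · rw [hQgt k hl, zero_mul]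
        · exact mul_nonpos_of_nonneg_of_nonpos (hQ i k) (hA.1 k l hkl)
    rw [Matrix.sub_apply, aorM_apply, aorM_apply, A₂_apply]
    simp [hQ0]
  rcases hwit with ⟨i, hi⟩ | ⟨-, i, j, hji, hij⟩
  · have := hzero i i
    rw [hMM, if_pos rfl] at this
    exact hi.ne' this
  · have := hzero i j
    rw [hMM, if_neg hji.ne', if_pos hji] at this
    exact hij.ne' this

theorem two_le_of_isAdmissible {n : ℕ} {A α : Matrix (Fin n) (Fin n) ℝ}
    (hα : IsAdmissible A α) : 2 ≤ n := by
  obtain ⟨i, j, hij, -⟩ := exists_Q₂_ne_zero hα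
  exact Fin.nontrivial_iff_two_le.1 ⟨i, j, hij⟩

theorem offNonpos_of_cond {γ : ℝ} (hA : IsZMatrix A) (hα : IsAdmissible A α)
    (h : SteinRosenbergCond A α γ ∨ LowerCond A α γ) : OffNonpos A α := by
  rcases h with (h | h | h | h) | h
  · exact h.2.offNonpos hA hα
  · exact h.2.1.offNonpos hA hα
  · exact h.2.1
  · exact h.2.1
  · exact h.1

/-- The row patterns are incompatible with the conditions on the last row. -/
theorem not_lastRowCond_of_rowPattern (hdiag : ∀ i, A i i = 1) (hirr : IsIrreducibleMatrix A)
    (hα : IsAdmissible A α) {S : Set (Fin (m + 1))} (hS : S.Nonempty)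
    (hcl : ∀ i ∈ S, ∀ j, j ∉ S → A₂ A α i j = 0)
    (hin : ∀ j ∈ S, ∃ i ∈ S, i ≠ j ∧ A₂ A α i j ≠ 0) (hp : ∀ i ∈ S, RowPattern A α i)
    (hrows : ∀ i, 0 < i → i < Fin.last m → RowCondSeven A α i) : ¬ LastRowCond A α := by
  have hn := two_le_of_isAdmissible hα
  have hsub : ∀ i ∈ S, i = 0 ∨ i = Fin.last m := fun i hi => by
    by_contra! h
    exact (hp i hi).not_rowCondSeven hirr hn hα
      (hrows i (Fin.pos_iff_ne_zero.2 h.1) (lt_of_le_of_ne (Fin.le_last i) h.2))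
  -- An element of S has an incoming edge from a different element of S, so S cannot be a singleton.
  have hmem : 0 ∈ S ∧ Fin.last m ∈ S := by
    obtain ⟨j, hj⟩ := hS
    obtain ⟨i, hi, hij, -⟩ := hin j hj
    rcases hsub j hj with rfl | rfl <;> rcases hsub i hi with rfl | rfl
    · exact absurd rfl hij
    · exact ⟨hj, hi⟩
    · exact ⟨hi, hj⟩
    · exact absurd rfl hij
  have hlast := hp _ hmem.2
  rintro (⟨j, k, hkj, h⟩ | h | ⟨j, hj0, hj, h⟩ | h | h)
  · exact hlast.not_pos_of_le hkj (Fin.le_last j) h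
  · exact hlast.not_last_zero hirr hn h
  · have hjS : j ∉ S := fun h => (hsub j h).elim hj0.ne' hj.ne
    rw [← A₂_eq_offEntry hdiag hα hj.ne', hcl _ hmem.2 j hjS] at h
    exact lt_irrefl _ h
  · exact (hp _ hmem.1).not_rowCondSix hirr hn hα h.1
  · exact (hp _ hmem.1).not_rowCondSix hirr hn hα h.1

end Conditions

end PrecAOR

theorem theorem3p8 {m : ℕ} (A α : Matrix (Fin (m + 1)) (Fin (m + 1)) ℝ) (γ ω : ℝ)
    (hdiag : ∀ i, A i i = 1)
    (hM : PrecAOR.IsNonsingularMMatrix A) (hirr : PrecAOR.IsIrreducibleMatrix A)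
    (hα : PrecAOR.IsAdmissible A α)
    (hω₀ : 0 < ω) (hω₁ : ω ≤ 1) (hγ₀ : 0 ≤ γ) (hγ₁ : γ ≤ 1)
    (hcond : PrecAOR.SteinRosenbergCond A α γ ∨ PrecAOR.LowerCond A α γ) :
    IsUnit (PrecAOR.aorM γ (PrecAOR.A₂ A α)) ∧
      PrecAOR.rho (PrecAOR.aorMatrix γ ω (PrecAOR.A₂ A α)) <
        PrecAOR.rho (PrecAOR.aorMatrix γ ω A) ∧
      PrecAOR.rho (PrecAOR.aorMatrix γ ω A) < 1 := by
  open PrecAOR in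
  have hn := two_le_of_isAdmissible hα
  obtain ⟨hu, hlt1, hlt | ⟨x, S, hx, hMx, hMN, hS, hcl, hin, hE⟩⟩ :=
    rho_lt_or_exists_stationary hM hdiag hirr hn hα (offNonpos_of_cond hM.1 hα hcond)
      hω₀ hω₁ hγ₀ hγ₁
  · exact ⟨hu, hlt, hlt1⟩
  exfalso
  have hpat := fun i hi k hk => pattern_of_aorResidual_mulVec_eq_zero hM.1 hdiag hirr hn hα
    hγ₀ hγ₁ hx hMx hMN (hE i hi) (k := k) hk
  rcases hγ₁.lt_or_eq with hγ | rfl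
  -- On S the rows of A⁽²⁾ are then those of A, so irreducibility of A makes S everything and Q₂ =
  -- 0.
  · have hQ : ∀ i ∈ S, ∀ k, Q₂ A α i k = 0 := fun i hi k => by
      by_contra hk
      exact hγ.ne (hpat i hi k hk).1
    have huniv := eq_univ_of_isIrreducibleMatrix hirr hS fun i hi j hj => by
      simpa [A₂_apply, hQ i hi] using hcl i hi j hj
    obtain ⟨i, j, -, hij⟩ := exists_Q₂_ne_zero hα
    exact hij (hQ i (huniv i) j)
  · have hp : ∀ i ∈ S, RowPattern A α i := fun i hi k hk => (hpat i hi k hk).2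
    rcases hcond with (h | ⟨-, h, hg⟩ | h | ⟨-, -, hrows, hlast⟩) | h
    · exact lt_irrefl _ h.1
    · exact not_globalCond_of_rowPattern hirr hn hα
        (fun i => hp i (h.eq_univ hM.1 hdiag hirr hα hS hcl i)) hg
    · exact lt_irrefl _ h.1
    · exact not_lastRowCond_of_rowPattern hdiag hirr hα hS hcl hin hp hrows hlast
    · exact not_lowerCond_of_stationary hM hdiag hirr hα hx hMx hMN hS hcl hE h
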